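/- Theorem (Ball's conjecture). Let $n\in\mathbb{N}$ and let $\mathbb{R}^n$ carry its standard inner product $\langle\cdot,\cdot\rangle$ and Lebesgue measure. Let $K\subseteq\mathbb{R}^n$ be a symmetric convex body, that is, a compact convex set with nonempty interior such that $K=-K$. Let $K^\circ=\{x\in\mathbb{R}^n:\langle x,y\rangle\le 1\text{ for all }y\in K\}$ be its polar body and let $B_2^n=\{x\in\mathbb{R}^n:\langle x,x\rangle\le 1\}$ be the Euclidean unit ball. Then $$\int_K\int_{K^\circ}\langle x,y\rangle^2\,dx\,dy\;\le\;\int_{B_2^n}\int_{B_2^n}\langle x,y\rangle^2\,dx\,dy,$$ with equality if and only if $K$ is an origin symmetric ellipsoid, that is, $K=T(B_2^n)$ for some invertible linear map $T:\mathbb{R}^n\to\mathbb{R}^n$. -/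

import Mathlib

open MeasureTheory Metric

/-- The polar set `S° = {x : ⟪x, y⟫ ≤ 1 for all y ∈ S}` of a subset of `ℝⁿ`. -/
def polarBody {n : ℕ} (S : Set (EuclideanSpace ℝ (Fin n))) :
    Set (EuclideanSpace ℝ (Fin n)) :=
  {x | ∀ y ∈ S, inner ℝ x y ≤ 1}

/-- An origin symmetric (solid, nondegenerate) ellipsoid in `ℝⁿ`: the image of the closed Euclidean
unit ball under an invertible linear map. -/
def IsOriginSymmetricEllipsoid {n : ℕ} (S : Set (EuclideanSpace ℝ (Fin n))) : Prop :=
  ∃ T : EuclideanSpace ℝ (Fin n) ≃ₗ[ℝ] EuclideanSpace ℝ (Fin n), S = T '' closedBall 0 1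

/-- The double integral `∫_S ∫_T ⟪x, y⟫² dx dy` for subsets `S`, `T` of `ℝⁿ`. -/
noncomputable def innerSqIntegral {n : ℕ} (S T : Set (EuclideanSpace ℝ (Fin n))) : ℝ :=
  ∫ x in S, ∫ y in T, (inner ℝ x y) ^ 2

/-!
The functional `∫_K ∫_{K°} ⟪x, y⟫²` is invariant under linear automorphisms `T`, because
`(T K)° = T⁻ᵀ K°`. Diagonalizing the inertia operator of `K`, one may therefore assume that `K` is
in isotropic position, `∫_K ⟪w, x⟫² dx = a |w|²` for all `w`; the functional is then
`∑ᵢ a ∫_{K°} ⟪bᵢ, y⟫² dy` for any orthonormal basis `b`. It is enough to show that each summand is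
at most its value for the ball, and this follows from a Santaló inequality for second moments:
for every unit vector `u` there is a `w` with `⟪u, w⟫ = 1` such that
`∫_K ⟪w, x⟫² dx · ∫_{K°} ⟪u, y⟫² dy` is at most its value for the ball with `w = u`
(`IsSymmBody.exists_secondMoment_mul_le`). Indeed `|w| ≥ 1`, so the first factor is at least `a`.

To find `w`, replace the two bodies by the functions `exp (-‖x‖_K² / 2)` and `exp (-‖y‖_{K°}² / 2)`,
which have the same second moments up to a constant and whose product is at most `exp (-⟪x, y⟫)`.
By symmetry one may integrate over the half-spaces `⟪w, x⟫ > 0` and `⟪u, y⟫ > 0`. Take for `w` the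
multiple, normalized by `⟪u, w⟫ = 1`, of the barycenter of `⟪u, y⟫² exp (-‖y‖_{K°}² / 2)` on the
half-space. A shear of `ℝ × ℝᵈ` moves `w` to the first axis, and the dual shear of the variable `x`
preserves the pairing. On each pair of lines parallel to the first axis, the one-dimensional
Prékopa–Leindler inequality in logarithmic coordinates (`lintegral_Ioi_mul_le`) bounds the product
of the integrals by a constant times `exp (-⟪x, y⟫)`, where now `x, y ∈ ℝᵈ`. By the choice of `w`,
one of the two marginals on `ℝᵈ` has its barycenter at the origin, so the functional Santaló
inequality in dimension `d` applies to them.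

The functional Santaló inequality itself (`santalo`) is proved by induction on the dimension in the
same way. A hyperplane halving the mass of one function `g`, and the line through the barycenters of
the two halves, provide coordinates in which both halves of `g` have their barycenters on the first
axis (`exists_tilt`). Moving the point where they meet to the origin multiplies the other function
`f` by an exponential, which does not decrease its integral if `f` has its barycenter at the origin,
because `eᵃ ≥ 1 + a` (`lintegral_le_lintegral_tilt`).

If equality holds, then `w = u` for every `u`. Of the function `exp (-‖x‖_K² / 2)` the argument uses
only an upper bound that decreases along the half-lines in direction `u` that start in `u^⊥`;
equality therefore forces the function to decrease along them as well, so that the orthogonal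
projection onto `u^⊥` maps `K` into itself. A body with this property for every `u` is a ball
(`IsSymmBody.exists_gauge_eq_mul_norm`), since in a plane the projection onto a line at angle `θ`
shortens a vector only by the factor `cos θ = 1 - O(θ²)`.
-/

namespace BallConjecture

open Set Filter Topology
open scoped ENNReal NNReal Pointwise

/-! ### The one-dimensional Prékopa–Leindler inequality -/

/-- The one-dimensional Brunn–Minkowski inequality for compact sets: the translates `A + min B`
and `max A + B` lie in `A + B` and meet in a single point. -/
theorem volume_add_volume_le_of_isCompact {A B : Set ℝ} (hA : IsCompact A) (hB : IsCompact B)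
    (hA' : A.Nonempty) (hB' : B.Nonempty) : volume A + volume B ≤ volume (A + B) := by
  have ha := hA.sSup_mem hA'
  have hb := hB.sInf_mem hB'
  set a := sSup A
  set b := sInf B
  have h1 : volume ((fun x => x + b) '' A) = volume A := by
    simp [Set.image_add_right]
  have h2 : volume ((fun x => a + x) '' B) = volume B := by
    simp [Set.image_add_left]
  have hm : MeasurableSet ((fun x => a + x) '' B) :=
    (hB.image (by fun_prop)).measurableSet
  have h3 := measure_union_add_inter (μ := volume) ((fun x => x + b) '' A) hm
  have h4 : volume ((fun x => x + b) '' A ∩ (fun x => a + x) '' B) = 0 := by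
    refine measure_mono_null (t := {a + b}) ?_ (by simp)
    rintro _ ⟨⟨x, hx, rfl⟩, ⟨y, hy, hxy⟩⟩
    have := le_csSup hA.bddAbove hx
    have := csInf_le hB.bddBelow hy
    simp only [mem_singleton_iff]
    simp only at hxy
    linarith
  rw [h4, h1, h2, add_zero] at h3
  rw [← h3]
  refine measure_mono (union_subset ?_ ?_)
  · rintro _ ⟨x, hx, rfl⟩
    exact add_mem_add hx hb
  · rintro _ ⟨x, hx, rfl⟩
    exact add_mem_add ha hx

/-- The one-dimensional Brunn–Minkowski inequality for measurable sets, by inner regularity; as `C`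
need not be measurable, this avoids the measurability of `A + B`. -/
theorem volume_add_volume_le_of_midpoint_mem {A B C : Set ℝ} (hA : MeasurableSet A)
    (hB : MeasurableSet B) (hA' : A.Nonempty) (hB' : B.Nonempty)
    (h : ∀ a ∈ A, ∀ b ∈ B, (a + b) / 2 ∈ C) : volume A + volume B ≤ 2 * volume C := by
  obtain ⟨a, ha⟩ := hA'
  obtain ⟨b, hb⟩ := hB'
  rw [hA.measure_eq_iSup_isCompact, hB.measure_eq_iSup_isCompact]
  simp only [iSup_and']
  refine ENNReal.biSup_add_biSup_le' ⟨∅, by simp⟩ ⟨∅, by simp⟩ ?_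
  rintro S ⟨hSA, hS⟩ T ⟨hTB, hT⟩
  calc volume S + volume T ≤ volume (insert a S) + volume (insert b T) := by
        gcongr <;> exact subset_insert _ _
    _ ≤ volume (insert a S + insert b T) :=
        volume_add_volume_le_of_isCompact (hS.insert a) (hT.insert b) (insert_nonempty _ _)
          (insert_nonempty _ _)
    _ ≤ volume ((2 : ℝ) • C) := by
        refine measure_mono ?_
        rintro _ ⟨x, hx, y, hy, rfl⟩
        have hx' : x ∈ A := insert_subset ha hSA hx
        have hy' : y ∈ B := insert_subset hb hTB hy
        refine ⟨(x + y) / 2, h x hx' y hy', ?_⟩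
        simp only [smul_eq_mul]
        ring
    _ = 2 * volume C := by
        rw [Measure.addHaar_smul]
        simp

theorem mul_le_sq_of_add_le_two_mul {x y z : ℝ≥0∞} (h : x + y ≤ 2 * z) : x * y ≤ z ^ 2 := by
  rcases eq_or_ne z ⊤ with rfl | hz
  · simp
  have h2 : 2 * z ≠ ⊤ := ENNReal.mul_ne_top (by simp) hz
  have hx : x ≠ ⊤ := ne_top_of_le_ne_top h2 (le_self_add.trans h)
  have hy : y ≠ ⊤ := ne_top_of_le_ne_top h2 (le_add_self.trans h)
  lift x to ℝ≥0 using hx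
  lift y to ℝ≥0 using hy
  lift z to ℝ≥0 using hz
  norm_cast at h ⊢
  have h' : (x : ℝ) + y ≤ 2 * z := by exact_mod_cast h
  have : (x : ℝ) * y ≤ z ^ 2 := by
    nlinarith [sq_nonneg ((x : ℝ) - y), x.coe_nonneg, y.coe_nonneg, z.coe_nonneg]
  exact_mod_cast this

/-- The Prékopa–Leindler inequality on `ℝ`, with exponent `1 / 2`, for bounded functions. After
rescaling to supremum `1`, all the nontrivial superlevel sets of `P` and `Q` are nonempty, and
the Brunn–Minkowski inequality applies to them. -/
theorem prekopa_leindler_of_bounded {P Q R : ℝ → ℝ} (hP : Measurable P) (hQ : Measurable Q)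
    (hR : Measurable R) (hP0 : ∀ x, 0 ≤ P x) (hQ0 : ∀ x, 0 ≤ Q x) (hR0 : ∀ x, 0 ≤ R x)
    (hPb : BddAbove (range P)) (hQb : BddAbove (range Q))
    (h : ∀ a b, P a * Q b ≤ R ((a + b) / 2) ^ 2) :
    (∫⁻ x, ENNReal.ofReal (P x)) * (∫⁻ x, ENNReal.ofReal (Q x))
      ≤ (∫⁻ x, ENNReal.ofReal (R x)) ^ 2 := by
  by_cases hPz : ∀ x, P x = 0
  · simp [hPz]
  by_cases hQz : ∀ x, Q x = 0
  · simp [hQz]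
  push Not at hPz hQz
  obtain ⟨x0, hx0⟩ := hPz
  obtain ⟨y0, hy0⟩ := hQz
  set α := ⨆ x, P x
  set β := ⨆ x, Q x
  have hα : 0 < α := ((hP0 x0).lt_of_ne' hx0).trans_le (le_ciSup hPb x0)
  have hβ : 0 < β := ((hQ0 y0).lt_of_ne' hy0).trans_le (le_ciSup hQb y0)
  set γ := √(α * β)
  have hγ : 0 < γ := Real.sqrt_pos.2 (mul_pos hα hβ)
  have hγ2 : γ ^ 2 = α * β := Real.sq_sqrt (mul_pos hα hβ).le
  have key : (∫⁻ x, ENNReal.ofReal (P x / α)) + (∫⁻ x, ENNReal.ofReal (Q x / β))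
      ≤ 2 * ∫⁻ x, ENNReal.ofReal (R x / γ) := by
    rw [lintegral_eq_lintegral_meas_lt volume (ae_of_all _ fun x => div_nonneg (hP0 x) hα.le)
        (hP.div_const _).aemeasurable,
      lintegral_eq_lintegral_meas_lt volume (ae_of_all _ fun x => div_nonneg (hQ0 x) hβ.le)
        (hQ.div_const _).aemeasurable,
      lintegral_eq_lintegral_meas_lt volume (ae_of_all _ fun x => div_nonneg (hR0 x) hγ.le)
        (hR.div_const _).aemeasurable]
    have hanti : ∀ F : ℝ → ℝ, Measurable fun t : ℝ => volume {a : ℝ | t < F a} := fun F =>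
      Antitone.measurable fun s t hst => measure_mono fun a (ha : t < F a) => hst.trans_lt ha
    rw [← lintegral_add_left (hanti _), ← lintegral_const_mul _ (hanti _)]
    refine setLIntegral_mono' measurableSet_Ioi fun t (ht : 0 < t) => ?_
    rcases le_or_gt 1 t with h1 | h1
    · have e1 : {a | t < P a / α} = ∅ := by
        ext a
        simp only [mem_ofPred_eq, mem_empty_iff_false, iff_false, not_lt]
        exact ((div_le_one hα).2 (le_ciSup hPb a)).trans h1
      have e2 : {a | t < Q a / β} = ∅ := by
        ext a
        simp only [mem_ofPred_eq, mem_empty_iff_false, iff_false, not_lt]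
        exact ((div_le_one hβ).2 (le_ciSup hQb a)).trans h1
      simp [e1, e2]
    · refine volume_add_volume_le_of_midpoint_mem
        (measurableSet_lt measurable_const (hP.div_const _))
        (measurableSet_lt measurable_const (hQ.div_const _)) ?_ ?_ ?_
      · obtain ⟨x, hx⟩ := exists_lt_of_lt_ciSup (show t * α < ⨆ x, P x by
          change t * α < α; nlinarith)
        exact ⟨x, (lt_div_iff₀ hα).2 hx⟩
      · obtain ⟨x, hx⟩ := exists_lt_of_lt_ciSup (show t * β < ⨆ x, Q x by
          change t * β < β; nlinarith)
        exact ⟨x, (lt_div_iff₀ hβ).2 hx⟩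
      · intro a ha b hb
        simp only [mem_ofPred_eq] at ha hb ⊢
        rw [lt_div_iff₀ hα] at ha
        rw [lt_div_iff₀ hβ] at hb
        rw [lt_div_iff₀ hγ]
        refine lt_of_pow_lt_pow_left₀ 2 (hR0 _) (lt_of_lt_of_le ?_ (h a b))
        calc (t * γ) ^ 2 = (t * α) * (t * β) := by rw [mul_pow, hγ2]; ring
          _ < P a * Q b := mul_lt_mul'' ha hb (by positivity) (by positivity)
  have scale : ∀ (F : ℝ → ℝ) (c : ℝ), 0 < c → Measurable F → ∫⁻ x, ENNReal.ofReal (F x)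
      = ENNReal.ofReal c * ∫⁻ x, ENNReal.ofReal (F x / c) := by
    intro F c hc hF
    rw [← lintegral_const_mul _ (by fun_prop)]
    congr 1 with x
    rw [← ENNReal.ofReal_mul hc.le, mul_div_cancel₀ _ hc.ne']
  rw [scale P α hα hP, scale Q β hβ hQ, scale R γ hγ hR, mul_pow, mul_mul_mul_comm,
    ← ENNReal.ofReal_mul hα.le, ← ENNReal.ofReal_pow hγ.le, hγ2]
  gcongr
  exact mul_le_sq_of_add_le_two_mul key

theorem lintegral_eq_iSup_lintegral_min {X : Type*} [MeasurableSpace X] {μ : Measure X}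
    {F : X → ℝ≥0∞} (hF : Measurable F) :
    ∫⁻ x, F x ∂μ = ⨆ n : ℕ, ∫⁻ x, min (F x) n ∂μ := by
  rw [← lintegral_iSup (f := fun (n : ℕ) x => min (F x) n) (fun n => by fun_prop)
    (fun m n hmn x => min_le_min le_rfl (by exact_mod_cast hmn))]
  congr 1 with x
  refine le_antisymm ?_ (iSup_le fun n => min_le_left _ _)
  rcases eq_or_ne (F x) ⊤ with h | h
  · simp [h, ENNReal.iSup_natCast]
  · obtain ⟨n, hn⟩ := ENNReal.exists_nat_gt h
    exact le_iSup_of_le n (by simp [hn.le])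

/-- The Prékopa–Leindler inequality on `ℝ` with exponent `1 / 2`. -/
theorem prekopa_leindler {P Q : ℝ → ℝ≥0∞} {R : ℝ → ℝ} (hP : Measurable P) (hQ : Measurable Q)
    (hR : Measurable R) (hR0 : ∀ x, 0 ≤ R x)
    (h : ∀ a b, P a * Q b ≤ ENNReal.ofReal (R ((a + b) / 2) ^ 2)) :
    (∫⁻ x, P x) * (∫⁻ x, Q x) ≤ (∫⁻ x, ENNReal.ofReal (R x)) ^ 2 := by
  rw [lintegral_eq_iSup_lintegral_min hP, lintegral_eq_iSup_lintegral_min hQ]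
  simp only [ENNReal.iSup_mul, ENNReal.mul_iSup]
  refine iSup_le fun m => iSup_le fun n => ?_
  have bdd : ∀ (F : ℝ → ℝ≥0∞) (k : ℕ), BddAbove (range fun x => (min (F x) k).toReal) := by
    rintro F k
    refine ⟨k, ?_⟩
    rintro _ ⟨x, rfl⟩
    exact ENNReal.toReal_le_of_le_ofReal (by positivity) (by simp)
  have fin : ∀ (x : ℝ≥0∞) (k : ℕ), min x k ≠ ⊤ := fun x k =>
    ne_top_of_le_ne_top (ENNReal.natCast_ne_top k) (min_le_right _ _)
  have := prekopa_leindler_of_bounded (P := fun x => (min (P x) n).toReal)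
    (Q := fun x => (min (Q x) m).toReal) (R := R) (by fun_prop) (by fun_prop) hR
    (fun _ => ENNReal.toReal_nonneg) (fun _ => ENNReal.toReal_nonneg) hR0 (bdd _ _) (bdd _ _) ?_
  · simpa only [ENNReal.ofReal_toReal (fin _ _)] using this
  · intro a b
    rw [← ENNReal.toReal_mul]
    refine ENNReal.toReal_le_of_le_ofReal (by positivity) (le_trans ?_ (h a b))
    gcongr <;> exact min_le_left _ _

theorem lintegral_Ioi_zero_eq_lintegral_exp (F : ℝ → ℝ≥0∞) :
    ∫⁻ s in Ioi 0, F s = ∫⁻ a, ENNReal.ofReal (Real.exp a) * F (Real.exp a) := by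
  have := lintegral_image_eq_lintegral_abs_deriv_mul (s := univ) (f := Real.exp)
    (f' := Real.exp) MeasurableSet.univ (fun x _ => (Real.hasDerivAt_exp x).hasDerivWithinAt)
    Real.exp_injective.injOn F
  simpa [image_univ, Real.range_exp, abs_of_pos (Real.exp_pos _)] using this

/-- The half-line Gaussian moment `∫₀^∞ zᵏ e^{-z²/2} dz`. -/
noncomputable def halfMoment (k : ℕ) : ℝ≥0∞ :=
  ∫⁻ z in Ioi (0 : ℝ), ENNReal.ofReal (z ^ k * Real.exp (-(z ^ 2 / 2)))

/-- The functional Santaló inequality on a half-line, with weight `sᵏ`: the Prékopa–Leindler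
inequality in the logarithmic coordinate `s = eᵃ`. -/
theorem lintegral_Ioi_mul_le {p q : ℝ → ℝ≥0∞} (hp : Measurable p) (hq : Measurable q) (k : ℕ)
    {c : ℝ} (hc : 0 ≤ c)
    (h : ∀ s > 0, ∀ t > 0, p s * q t ≤ ENNReal.ofReal (c * Real.exp (-(s * t)))) :
    (∫⁻ s in Ioi 0, ENNReal.ofReal (s ^ k) * p s) * (∫⁻ t in Ioi 0, ENNReal.ofReal (t ^ k) * q t)
      ≤ ENNReal.ofReal c * halfMoment k ^ 2 := by
  unfold halfMoment
  simp only [lintegral_Ioi_zero_eq_lintegral_exp]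
  have := prekopa_leindler
    (P := fun a => ENNReal.ofReal (Real.exp a) * (ENNReal.ofReal (Real.exp a ^ k) * p (Real.exp a)))
    (Q := fun a => ENNReal.ofReal (Real.exp a) * (ENNReal.ofReal (Real.exp a ^ k) * q (Real.exp a)))
    (R := fun m => √c * (Real.exp m * (Real.exp m ^ k * Real.exp (-(Real.exp m ^ 2 / 2)))))
    (by fun_prop) (by fun_prop) (by fun_prop) (fun x => by positivity) ?_
  · refine this.trans_eq ?_
    simp only [ENNReal.ofReal_mul (Real.sqrt_nonneg c)]
    rw [lintegral_const_mul _ (by fun_prop), mul_pow, ← ENNReal.ofReal_pow (Real.sqrt_nonneg c),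
      Real.sq_sqrt hc]
    simp only [ENNReal.ofReal_mul (Real.exp_pos _).le]
  · intro a b
    have hab : Real.exp ((a + b) / 2) ^ 2 = Real.exp a * Real.exp b := by
      rw [← Real.exp_nat_mul, ← Real.exp_add]
      congr 1
      push_cast
      ring
    calc _ = ENNReal.ofReal ((Real.exp a * Real.exp b) * (Real.exp a * Real.exp b) ^ k)
          * (p (Real.exp a) * q (Real.exp b)) := by
          rw [mul_pow, ENNReal.ofReal_mul (by positivity), ENNReal.ofReal_mul (by positivity),
            ENNReal.ofReal_mul (by positivity)]
          ring
      _ ≤ ENNReal.ofReal ((Real.exp a * Real.exp b) * (Real.exp a * Real.exp b) ^ k)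
          * ENNReal.ofReal (c * Real.exp (-(Real.exp a * Real.exp b))) := by
          gcongr
          exact h _ (Real.exp_pos _) _ (Real.exp_pos _)
      _ = _ := by
          rw [← ENNReal.ofReal_mul (by positivity)]
          congr 1
          have hE : ∀ x : ℝ, Real.exp (-(x / 2)) ^ 2 = Real.exp (-x) := fun x => by
            rw [← Real.exp_nat_mul]
            congr 1
            push_cast
            ring
          have hk : (Real.exp ((a + b) / 2) ^ k) ^ 2 = (Real.exp a * Real.exp b) ^ k := by
            rw [← pow_mul, mul_comm k 2, pow_mul, hab]
          have hsq : ∀ w x y z : ℝ, (w * (x * (y * z))) ^ 2 = w ^ 2 * (x ^ 2 * (y ^ 2 * z ^ 2)) :=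
            fun w x y z => by ring
          rw [hsq, Real.sq_sqrt hc, hk, hE, hab]
          ring

theorem halfMoment_ne_zero (k : ℕ) : halfMoment k ≠ 0 := by
  unfold halfMoment
  rw [← pos_iff_ne_zero, setLIntegral_pos_iff (by fun_prop)]
  refine (show (0 : ℝ≥0∞) < volume (Ioi (0 : ℝ)) by simp).trans_le (measure_mono fun z hz => ?_)
  have hz' : (0 : ℝ) < z := hz
  exact ⟨(ENNReal.ofReal_pos.2 (by positivity)).ne', hz⟩

theorem halfMoment_ne_top (k : ℕ) : halfMoment k ≠ ⊤ := by
  have := integrableOn_rpow_mul_exp_neg_mul_sq (b := 1 / 2) (by norm_num) (s := k)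
    (by linarith [k.cast_nonneg (α := ℝ)])
  refine ne_top_of_le_ne_top (lintegral_ofReal_le_lintegral_enorm _ |>.trans_lt this.2).ne ?_
  unfold halfMoment
  refine lintegral_mono fun z => ENNReal.ofReal_le_ofReal (le_of_eq ?_)
  rw [Real.rpow_natCast]
  ring_nf

/-- The functional Santaló inequality on a half-line with a possibly infinite constant. -/
theorem lintegral_Ioi_mul_le' {p q : ℝ → ℝ≥0∞} (hp : Measurable p) (hq : Measurable q) (k : ℕ)
    {c : ℝ≥0∞}
    (h : ∀ s > 0, ∀ t > 0, p s * q t ≤ c * ENNReal.ofReal (Real.exp (-(s * t)))) :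
    (∫⁻ s in Ioi 0, ENNReal.ofReal (s ^ k) * p s) * (∫⁻ t in Ioi 0, ENNReal.ofReal (t ^ k) * q t)
      ≤ c * halfMoment k ^ 2 := by
  rcases eq_or_ne c ⊤ with rfl | hc
  · rw [ENNReal.top_mul (pow_ne_zero _ (halfMoment_ne_zero k))]
    exact le_top
  · rw [← ENNReal.ofReal_toReal hc] at h ⊢
    refine lintegral_Ioi_mul_le hp hq k ENNReal.toReal_nonneg fun s hs t ht => ?_
    rw [ENNReal.ofReal_mul ENNReal.toReal_nonneg]
    exact h s hs t ht

section

/-! ### Medians -/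

/-- A finite measure on `ℝ` without atoms has a median. -/
theorem exists_measure_Iio_eq_measure_Ioi (m : Measure ℝ) [IsFiniteMeasure m]
    [NullSingletonClass m] : ∃ τ, m (Iio τ) = m (Ioi τ) := by
  rcases eq_or_ne (m univ) 0 with h0 | h0
  · exact ⟨0, by rw [measure_mono_null (subset_univ _) h0, measure_mono_null (subset_univ _) h0]⟩
  set M := m univ
  have hMt : M ≠ ⊤ := measure_ne_top _ _
  have hsplit : ∀ t, m (Iio t) + m (Ioi t) = M := by
    intro t
    rw [measure_congr (Ioi_ae_eq_Ici (a := t)), ← measure_union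
      (by rw [disjoint_left]; intro x (h : x < t) (h' : t ≤ x); exact absurd h' (not_le.2 h))
      measurableSet_Ici, Iio_union_Ici]
  have hhalf : M / 2 < M := ENNReal.half_lt_self h0 hMt
  set S := {t : ℝ | m (Iio t) ≤ M / 2}
  have hlow : ∃ t, m (Iio t) ≤ M / 2 := by
    have h1 : (⋂ n : ℕ, Iio (-(n : ℝ))) = ∅ := by
      ext x
      simp only [mem_iInter, mem_Iio, mem_empty_iff_false, iff_false, not_forall, not_lt]
      obtain ⟨n, hn⟩ := exists_nat_gt (-x)
      exact ⟨n, by linarith⟩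
    have h2 := tendsto_measure_iInter_atTop (μ := m) (s := fun n : ℕ => Iio (-(n : ℝ)))
      (fun n => measurableSet_Iio.nullMeasurableSet)
      (fun i j hij => Iio_subset_Iio (neg_le_neg (by exact_mod_cast hij)))
      ⟨0, measure_ne_top _ _⟩
    rw [h1, measure_empty] at h2
    obtain ⟨n, hn⟩ := (h2.eventually_lt_const (ENNReal.half_pos h0)).exists
    exact ⟨_, hn.le⟩
  have hhigh : ∃ t, M / 2 < m (Iio t) := by
    have h1 : (⋃ n : ℕ, Iio (n : ℝ)) = univ := by
      ext x
      simp only [mem_iUnion, mem_Iio, mem_univ, iff_true]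
      exact exists_nat_gt x
    have h2 := tendsto_measure_iUnion_atTop (μ := m) (s := fun n : ℕ => Iio (n : ℝ))
      (fun i j hij => Iio_subset_Iio (by exact_mod_cast hij))
    rw [h1] at h2
    obtain ⟨n, hn⟩ := (h2.eventually_const_lt hhalf).exists
    exact ⟨_, hn⟩
  obtain ⟨b, hb⟩ := hhigh
  have hbdd : BddAbove S := ⟨b, fun t ht => by
    by_contra! hlt
    exact absurd (hb.trans_le (measure_mono (Iio_subset_Iio hlt.le))) (not_lt.2 ht)⟩
  have hSne : S.Nonempty := hlow
  set τ := sSup S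
  have hleft : m (Iio τ) ≤ M / 2 := by
    have h1 : (⋃ n : ℕ, Iio (τ - 1 / ((n : ℝ) + 1))) = Iio τ := by
      ext x
      simp only [mem_iUnion, mem_Iio]
      constructor
      · rintro ⟨n, hn⟩
        have : (0 : ℝ) < 1 / ((n : ℝ) + 1) := by positivity
        linarith
      · intro hx
        obtain ⟨n, hn⟩ := exists_nat_one_div_lt (sub_pos.2 hx)
        exact ⟨n, by linarith⟩
    have hmono : Monotone fun n : ℕ => Iio (τ - 1 / ((n : ℝ) + 1)) := fun i j hij =>
      Iio_subset_Iio (sub_le_sub_left (one_div_le_one_div_of_le (by positivity)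
        (by exact_mod_cast Nat.succ_le_succ hij)) _)
    rw [← h1, hmono.measure_iUnion]
    refine iSup_le fun n => ?_
    obtain ⟨t, ht, hlt⟩ := exists_lt_of_lt_csSup hSne
      (show τ - 1 / ((n : ℝ) + 1) < sSup S from sub_lt_self _ (by positivity))
    exact (measure_mono (Iio_subset_Iio hlt.le)).trans ht
  have hright : m (Ioi τ) ≤ M / 2 := by
    have h1 : (⋃ n : ℕ, Ioi (τ + 1 / ((n : ℝ) + 1))) = Ioi τ := by
      ext x
      simp only [mem_iUnion, mem_Ioi]
      constructor
      · rintro ⟨n, hn⟩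
        have : (0 : ℝ) < 1 / ((n : ℝ) + 1) := by positivity
        linarith
      · intro hx
        obtain ⟨n, hn⟩ := exists_nat_one_div_lt (sub_pos.2 hx)
        exact ⟨n, by linarith⟩
    have hmono : Monotone fun n : ℕ => Ioi (τ + 1 / ((n : ℝ) + 1)) := fun i j hij =>
      Ioi_subset_Ioi (add_le_add_right (one_div_le_one_div_of_le (by positivity)
        (by exact_mod_cast Nat.succ_le_succ hij)) _)
    rw [← h1, hmono.measure_iUnion]
    refine iSup_le fun n => ?_
    have hn : τ + 1 / ((n : ℝ) + 1) ∉ S := fun hmem =>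
      absurd (le_csSup hbdd hmem) (not_le.2 (lt_add_of_pos_right _ (by positivity)))
    have hn' : M / 2 < m (Iio (τ + 1 / ((n : ℝ) + 1))) := not_le.1 hn
    by_contra! hcon
    have := ENNReal.add_lt_add hn' hcon
    rw [ENNReal.add_halves, hsplit] at this
    exact lt_irrefl _ this
  refine ⟨τ, ?_⟩
  have h2 : M / 2 ≠ ⊤ := (hhalf.trans_le le_top).ne
  have hle1 : M / 2 ≤ m (Ioi τ) := by
    by_contra! hcon
    have := ENNReal.add_lt_add_of_le_of_lt (measure_ne_top m (Iio τ)) hleft hcon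
    rw [ENNReal.add_halves, hsplit] at this
    exact lt_irrefl _ this
  have hle2 : M / 2 ≤ m (Iio τ) := by
    by_contra! hcon
    have := ENNReal.add_lt_add_of_lt_of_le (measure_ne_top m (Ioi τ)) hcon hright
    rw [ENNReal.add_halves, hsplit] at this
    exact lt_irrefl _ this
  exact (le_antisymm hleft hle2).trans (le_antisymm hright hle1).symm

/-! ### Integration over half-spaces -/

/-- Lebesgue measure on the half-space `{(s, x) : s > 0}` of `ℝ × ℝᵈ`. -/
noncomputable def halfVolume (d : ℕ) : Measure (ℝ × (Fin d → ℝ)) :=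
  (volume.restrict (Ioi 0)).prod volume

instance (d : ℕ) : SFinite (halfVolume d) := by unfold halfVolume; infer_instance

variable {d : ℕ}

theorem ae_halfVolume_fst_pos : ∀ᵐ p ∂halfVolume d, 0 < p.1 := by
  have h : halfVolume d = (volume.prod volume).restrict (Ioi 0 ×ˢ univ) := by
    rw [← Measure.prod_restrict, Measure.restrict_univ]; rfl
  rw [h]
  filter_upwards [ae_restrict_mem (measurableSet_Ioi.prod MeasurableSet.univ)] with p hp
  exact hp.1

theorem lintegral_halfVolume {k : ℝ × (Fin d → ℝ) → ℝ≥0∞} (hk : Measurable k) :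
    ∫⁻ p, k p ∂halfVolume d = ∫⁻ x, ∫⁻ s in Ioi 0, k (s, x) := by
  rw [halfVolume, lintegral_prod_symm' _ hk]

theorem lintegral_eq_halfVolume_add {k : ℝ × (Fin d → ℝ) → ℝ≥0∞} (hk : Measurable k) :
    ∫⁻ p, k p = ∫⁻ p, k p ∂halfVolume d + ∫⁻ p, k (-p.1, p.2) ∂halfVolume d := by
  rw [lintegral_halfVolume hk, lintegral_halfVolume (by fun_prop), Measure.volume_eq_prod,
    lintegral_prod_symm' _ hk, ← lintegral_add_left (by
      exact Measurable.lintegral_prod_left' (f := k) hk)]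
  congr 1 with x
  have h1 : ∫⁻ s in Ioi (0 : ℝ), k (-s, x) = ∫⁻ s in Iio (0 : ℝ), k (s, x) := by
    have := (Measure.measurePreserving_neg (volume : Measure ℝ)).setLIntegral_comp_preimage
      (s := Iio 0) measurableSet_Iio (f := fun s => k (s, x)) (by fun_prop)
    rw [← this]
    simp
  rw [h1, setLIntegral_congr (Iio_ae_eq_Iic (a := (0 : ℝ))), add_comm,
    ← lintegral_union measurableSet_Ioi (by
      rw [disjoint_left]; intro y (h : y ≤ 0) (h' : 0 < y); linarith),
    Iic_union_Ioi, setLIntegral_univ]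

/-- The marginal of a density on the half-space. -/
theorem withDensity_marginal {k : ℝ × (Fin d → ℝ) → ℝ≥0∞} (hk : Measurable k) :
    (volume.withDensity fun x => ∫⁻ s in Ioi 0, k (s, x))
      = ((halfVolume d).withDensity k).map Prod.snd := by
  refine Measure.ext_of_lintegral _ fun φ hφ => ?_
  have hG : Measurable fun x => ∫⁻ s in Ioi 0, k (s, x) :=
    Measurable.lintegral_prod_left' (f := k) hk
  rw [lintegral_withDensity_eq_lintegral_mul _ hG hφ, lintegral_map hφ measurable_snd,
    lintegral_withDensity_eq_lintegral_mul _ hk (by fun_prop), lintegral_halfVolume (by fun_prop)]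
  congr 1 with x
  simp only [Pi.mul_apply]
  rw [lintegral_mul_const _ (by fun_prop)]

/-- A measure on `ℝᵈ` has its barycenter at the origin. -/
def Centered (μ : Measure (Fin d → ℝ)) : Prop :=
  ∀ w, Integrable (fun x => x ⬝ᵥ w) μ ∧ ∫ x, x ⬝ᵥ w ∂μ = 0

/-- The functional Santaló inequality in dimension `d`, for a pair of functions of which one has
its barycenter at the origin. The constant `4 * halfMoment 0 ^ 2` is `2π`. -/
def Santalo (d : ℕ) : Prop :=
  ∀ (f g : (Fin d → ℝ) → ℝ≥0∞) (c : ℝ≥0∞), Measurable f → Measurable g →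
    (∀ x y, f x * g y ≤ c * ENNReal.ofReal (Real.exp (-(x ⬝ᵥ y)))) →
    ∫⁻ x, f x ≠ ⊤ → Centered (volume.withDensity f) →
    (∫⁻ x, f x) * (∫⁻ y, g y) ≤ c * (4 * halfMoment 0 ^ 2) ^ d

/-- The standard pairing on `ℝ × ℝᵈ`. -/
def pairing (p q : ℝ × (Fin d → ℝ)) : ℝ := p.1 * q.1 + p.2 ⬝ᵥ q.2

@[fun_prop]
theorem Measurable.pairing {X : Type*} [MeasurableSpace X] {f g : X → ℝ × (Fin d → ℝ)}
    (hf : Measurable f) (hg : Measurable g) : Measurable fun x => pairing (f x) (g x) := by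
  unfold BallConjecture.pairing dotProduct
  fun_prop

/-- The half-space Santaló inequality with weight `tʲ`: integrating along the lines parallel to
the first axis reduces it, by the one-dimensional inequality, to dimension `d`. -/
theorem lintegral_halfVolume_mul_le (hS : Santalo d) (j : ℕ)
    {f g : ℝ × (Fin d → ℝ) → ℝ≥0∞} (hf : Measurable f) (hg : Measurable g) {c : ℝ≥0∞}
    (h : ∀ x y, 0 < x.1 → 0 < y.1 → f x * g y ≤ c * ENNReal.ofReal (Real.exp (-pairing x y)))
    (hfin : ∫⁻ y, ENNReal.ofReal (y.1 ^ j) * g y ∂halfVolume d ≠ ⊤)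
    (hcen : Centered
      (((halfVolume d).withDensity fun y => ENNReal.ofReal (y.1 ^ j) * g y).map Prod.snd)) :
    (∫⁻ x, ENNReal.ofReal (x.1 ^ j) * f x ∂halfVolume d)
        * (∫⁻ y, ENNReal.ofReal (y.1 ^ j) * g y ∂halfVolume d)
      ≤ c * halfMoment j ^ 2 * (4 * halfMoment 0 ^ 2) ^ d := by
  have hmf : Measurable fun x : ℝ × (Fin d → ℝ) => ENNReal.ofReal (x.1 ^ j) * f x := by fun_prop
  have hmg : Measurable fun x : ℝ × (Fin d → ℝ) => ENNReal.ofReal (x.1 ^ j) * g x := by fun_prop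
  rw [← withDensity_marginal hmg] at hcen
  rw [lintegral_halfVolume hmg] at hfin
  rw [mul_comm, lintegral_halfVolume hmf, lintegral_halfVolume hmg]
  refine hS _ _ _ (Measurable.lintegral_prod_left' hmg) (Measurable.lintegral_prod_left' hmf) ?_
    hfin hcen
  intro y x
  rw [mul_comm, mul_right_comm]
  refine lintegral_Ioi_mul_le' (p := fun s => f (s, x)) (q := fun t => g (t, y)) (by fun_prop)
    (by fun_prop) j fun s hs t ht => ?_
  refine (h (s, x) (t, y) hs ht).trans_eq ?_
  rw [mul_assoc, ← ENNReal.ofReal_mul (by positivity), ← Real.exp_add]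
  congr 3
  simp only [pairing]
  rw [dotProduct_comm]
  ring

theorem santalo_zero : Santalo 0 := by
  intro f g c hf hg h _ _
  have h1 : ∀ k : (Fin 0 → ℝ) → ℝ≥0∞, ∫⁻ x, k x = k 0 := fun k => by
    rw [Measure.volume_pi_eq_dirac 0, lintegral_dirac]
  rw [h1, h1]
  simpa using h 0 0

/-- The Santaló inequality for a function `g` whose two halves have equal mass and have their
barycenters on the first axis. -/
theorem lintegral_mul_le_of_balanced (hS : Santalo d) {f g : ℝ × (Fin d → ℝ) → ℝ≥0∞}
    (hf : Measurable f) (hg : Measurable g) {c : ℝ≥0∞}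
    (h : ∀ x y, f x * g y ≤ c * ENNReal.ofReal (Real.exp (-pairing x y)))
    (hfin : ∫⁻ y, g y ∂halfVolume d ≠ ⊤)
    (heq : ∫⁻ y, g (-y.1, y.2) ∂halfVolume d = ∫⁻ y, g y ∂halfVolume d)
    (hcen : Centered (((halfVolume d).withDensity g).map Prod.snd))
    (hcen' : Centered (((halfVolume d).withDensity fun y => g (-y.1, y.2)).map Prod.snd)) :
    (∫⁻ x, f x) * (∫⁻ y, g y) ≤ c * (4 * halfMoment 0 ^ 2) ^ (d + 1) := by
  have h1 := lintegral_halfVolume_mul_le hS 0 hf hg (fun x y _ _ => h x y)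
    (by simpa using hfin) (by simpa using hcen)
  have h2 := lintegral_halfVolume_mul_le hS 0 (f := fun x => f (-x.1, x.2))
    (g := fun y => g (-y.1, y.2)) (c := c) (by fun_prop) (by fun_prop)
    (fun x y _ _ => by
      refine (h _ _).trans_eq ?_
      simp [pairing])
    (by simpa [heq] using hfin) (by simpa using hcen')
  simp only [pow_zero, ENNReal.ofReal_one, one_mul] at h1 h2
  rw [heq] at h2
  rw [lintegral_eq_halfVolume_add hf, lintegral_eq_halfVolume_add hg, heq, add_mul, mul_add,
    mul_add]
  calc _ ≤ c * halfMoment 0 ^ 2 * (4 * halfMoment 0 ^ 2) ^ d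
      + c * halfMoment 0 ^ 2 * (4 * halfMoment 0 ^ 2) ^ d
      + (c * halfMoment 0 ^ 2 * (4 * halfMoment 0 ^ 2) ^ d
      + c * halfMoment 0 ^ 2 * (4 * halfMoment 0 ^ 2) ^ d) := by gcongr
    _ = _ := by ring

/-! ### Shears -/

/-- The affine shear `(t, y) ↦ (t, z + y + t v)`. -/
def shear (z v : Fin d → ℝ) (p : ℝ × (Fin d → ℝ)) : ℝ × (Fin d → ℝ) := (p.1, z + p.2 + p.1 • v)

@[fun_prop]
theorem measurable_shear (z v : Fin d → ℝ) : Measurable (shear z v) := by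
  unfold shear
  fun_prop

theorem measurePreserving_shear (z v : Fin d → ℝ) :
    MeasurePreserving (shear z v) (halfVolume d) (halfVolume d) := by
  refine (MeasurePreserving.id (volume.restrict (Ioi (0 : ℝ)))).skew_product
    (g := fun t y => z + y + t • v) (by simp only [Function.uncurry_def]; fun_prop)
    (ae_of_all _ fun t => ?_)
  have : (fun y : Fin d → ℝ => z + y + t • v) = fun y => y + (z + t • v) := by
    ext1 y
    abel
  rw [this]
  exact map_add_right_eq_self _ _

theorem map_shear_withDensity (z v : Fin d → ℝ) {k : ℝ × (Fin d → ℝ) → ℝ≥0∞} (hk : Measurable k) :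
    ((halfVolume d).withDensity fun p => k (shear z v p)).map (shear z v)
      = (halfVolume d).withDensity k := by
  refine Measure.ext_of_lintegral _ fun φ hφ => ?_
  rw [lintegral_map hφ (by fun_prop), lintegral_withDensity_eq_lintegral_mul _ (by fun_prop)
    (by fun_prop), lintegral_withDensity_eq_lintegral_mul _ hk hφ,
    ← (measurePreserving_shear z v).lintegral_comp (f := k * φ) (by fun_prop)]
  rfl

/-- A shear along the line through the barycenter moves the barycenter to the first axis. -/
theorem centered_shear {z v : Fin d → ℝ} {k : ℝ × (Fin d → ℝ) → ℝ≥0∞} (hk : Measurable k)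
    {μ : Measure (ℝ × (Fin d → ℝ))} [IsFiniteMeasure μ] (hμ : μ = (halfVolume d).withDensity k)
    (h1 : Integrable (fun p => p.1) μ) (h2 : Integrable (fun p => p.2) μ)
    (h : ∫ p, p.2 ∂μ = μ.real univ • z + (∫ p, p.1 ∂μ) • v) :
    Centered (((halfVolume d).withDensity fun p => k (shear z v p)).map Prod.snd) := by
  set ν := (halfVolume d).withDensity fun p => k (shear z v p)
  have hν : ν.map (shear z v) = μ := by rw [map_shear_withDensity z v hk, hμ]
  intro w
  have hm : Measurable fun x : Fin d → ℝ => x ⬝ᵥ w := by unfold dotProduct; fun_prop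
  set q : ℝ × (Fin d → ℝ) → ℝ := fun p => p.2 ⬝ᵥ w - z ⬝ᵥ w - p.1 * (v ⬝ᵥ w)
  have hqm : Measurable q := by unfold q dotProduct; fun_prop
  have hq : (fun p : ℝ × (Fin d → ℝ) => p.2 ⬝ᵥ w) = fun p => q (shear z v p) := by
    ext1 p
    simp only [q, shear, add_dotProduct, smul_dotProduct, smul_eq_mul]
    ring
  have hi : ∀ i, Integrable (fun p : ℝ × (Fin d → ℝ) => p.2 i) μ := fun i => h2.eval i
  have hw : Integrable (fun p : ℝ × (Fin d → ℝ) => p.2 ⬝ᵥ w) μ := by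
    unfold dotProduct
    exact integrable_finsetSum _ fun i _ => (hi i).mul_const _
  have hw' : ∫ p, p.2 ⬝ᵥ w ∂μ = (∫ p, p.2 ∂μ) ⬝ᵥ w := by
    unfold dotProduct
    rw [integral_finsetSum _ fun i _ => (hi i).mul_const _]
    refine Finset.sum_congr rfl fun i _ => ?_
    rw [integral_mul_const, eval_integral fun i => hi i]
  have hqi : Integrable q μ := (hw.sub (integrable_const _)).sub (h1.mul_const _)
  have hqν : Integrable (fun p => q (shear z v p)) ν := by
    rw [← hν] at hqi
    exact hqi.comp_measurable (measurable_shear z v)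
  rw [integrable_map_measure hm.aestronglyMeasurable measurable_snd.aemeasurable,
    integral_map measurable_snd.aemeasurable hm.aestronglyMeasurable]
  refine ⟨?_, ?_⟩
  · change Integrable (fun p : ℝ × (Fin d → ℝ) => p.2 ⬝ᵥ w) ν
    rw [hq]
    exact hqν
  · rw [hq, ← integral_map (φ := shear z v) (by fun_prop) hqm.aestronglyMeasurable, hν]
    change ∫ p, (p.2 ⬝ᵥ w - z ⬝ᵥ w - p.1 * (v ⬝ᵥ w)) ∂μ = 0
    have e1 := integral_sub (hw.sub (integrable_const (z ⬝ᵥ w))) (h1.mul_const (v ⬝ᵥ w))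
    have e2 := integral_sub hw (integrable_const (z ⬝ᵥ w))
    simp only [Pi.sub_apply] at e1
    rw [e1, e2, hw', h, integral_mul_const, integral_const]
    simp only [add_dotProduct, smul_dotProduct, smul_eq_mul]
    ring

end

section

variable {d : ℕ}

/-! ### The functional Santaló inequality -/

theorem halfVolume_eq_restrict :
    halfVolume d = (volume : Measure (ℝ × (Fin d → ℝ))).restrict (Ioi 0 ×ˢ univ) := by
  rw [Measure.volume_eq_prod, ← Measure.prod_restrict, Measure.restrict_univ]
  rfl

theorem integral_fst_pos {μ : Measure (ℝ × (Fin d → ℝ))} (hμ : μ ≪ halfVolume d) (h0 : μ ≠ 0)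
    (hi : Integrable (fun p => p.1) μ) : 0 < ∫ p, p.1 ∂μ := by
  have hpos : ∀ᵐ p ∂μ, 0 < p.1 := hμ.ae_le ae_halfVolume_fst_pos
  have hnn : 0 ≤ᵐ[μ] fun p : ℝ × (Fin d → ℝ) => p.1 := hpos.mono fun p hp => hp.le
  refine (integral_nonneg_of_ae hnn).lt_of_ne' fun h => h0 ?_
  rw [integral_eq_zero_iff_of_nonneg_ae hnn hi] at h
  rw [← ae_eq_bot, ← Filter.eventually_false_iff_eq_bot]
  filter_upwards [h, hpos] with p hp hp'
  exact hp'.ne' hp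

/-- A density on the part of `ℝ × ℝᵈ` on one side of a hyperplane, in half-space coordinates. -/
theorem map_halfVolume_withDensity {e : ℝ → ℝ} (he : MeasurePreserving e volume volume)
    {I : Set ℝ} (hI : MeasurableSet I) (hIe : e ⁻¹' I = Ioi 0)
    {g : ℝ × (Fin d → ℝ) → ℝ≥0∞} (hg : Measurable g) :
    ((halfVolume d).withDensity fun p => g (e p.1, p.2)).map (fun p => (e p.1, p.2))
      = (volume.withDensity g).restrict (I ×ˢ univ) := by
  have hE : MeasurePreserving (fun p : ℝ × (Fin d → ℝ) => (e p.1, p.2)) volume volume :=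
    he.prod (MeasurePreserving.id volume)
  have hEm := hE.measurable
  refine Measure.ext_of_lintegral _ fun φ hφ => ?_
  rw [restrict_withDensity (hI.prod MeasurableSet.univ), lintegral_map hφ hEm,
    lintegral_withDensity_eq_lintegral_mul (halfVolume d)
      (f := fun p : ℝ × (Fin d → ℝ) => g (e p.1, p.2)) (hg.comp hEm)
      (g := fun p : ℝ × (Fin d → ℝ) => φ (e p.1, p.2)) (hφ.comp hEm),
    lintegral_withDensity_eq_lintegral_mul _ hg hφ,
    ← hE.setLIntegral_comp_preimage (hI.prod MeasurableSet.univ) (hg.mul hφ),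
    halfVolume_eq_restrict]
  have : (fun p : ℝ × (Fin d → ℝ) => (e p.1, p.2)) ⁻¹' (I ×ˢ univ) = Ioi 0 ×ˢ univ := by
    ext p
    simp [← hIe]
  rw [this]
  rfl

theorem measurePreserving_affine_shear (τ : ℝ) (z v : Fin d → ℝ) :
    MeasurePreserving (fun p : ℝ × (Fin d → ℝ) => (τ + p.1, z + p.2 + p.1 • v)) volume volume := by
  refine (measurePreserving_add_left volume τ).skew_product
    (g := fun t y => z + y + t • v) (by simp only [Function.uncurry_def]; fun_prop)
    (ae_of_all _ fun t => ?_)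
  have : (fun y : Fin d → ℝ => z + y + t • v) = fun y => y + (z + t • v) := by
    ext1 y
    abel
  rw [this]
  exact map_add_right_eq_self _ _

/-- The shear dual to `shear 0 v`. -/
def dualShear (v : Fin d → ℝ) (p : ℝ × (Fin d → ℝ)) : ℝ × (Fin d → ℝ) := (p.1 - p.2 ⬝ᵥ v, p.2)

@[fun_prop]
theorem measurable_dualShear (v : Fin d → ℝ) : Measurable (dualShear v) := by
  unfold dualShear dotProduct
  fun_prop

theorem measurePreserving_dualShear (v : Fin d → ℝ) :
    MeasurePreserving (dualShear v) volume volume := by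
  have h : MeasurePreserving (fun p : (Fin d → ℝ) × ℝ => (p.1, p.2 - p.1 ⬝ᵥ v))
      (volume.prod volume) (volume.prod volume) :=
    (MeasurePreserving.id volume).skew_product
      (g := fun (x : Fin d → ℝ) (s : ℝ) => s - x ⬝ᵥ v)
      (by simp only [Function.uncurry_def, dotProduct]; fun_prop)
      (ae_of_all _ fun x => by
        simpa only [sub_eq_add_neg] using map_add_right_eq_self (volume : Measure ℝ) (-(x ⬝ᵥ v)))
  exact (Measure.measurePreserving_swap.comp h).comp Measure.measurePreserving_swap

theorem pairing_dualShear_affine_shear (τ : ℝ) (z v : Fin d → ℝ) (x y : ℝ × (Fin d → ℝ)) :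
    pairing (dualShear v x) (τ + y.1, z + y.2 + y.1 • v)
      = pairing x y + pairing (dualShear v x) (τ, z) := by
  simp only [pairing, dualShear, dotProduct_add, dotProduct_smul, smul_eq_mul]
  ring

/-- For every `g` there is an exponential tilt making the Santaló inequality true for all `f`.
The hyperplane `{t = τ}` halves the mass of `g`, and `(τ, z)` is the point where it meets the line
through the barycenters of the two halves; in coordinates in which this point is the origin and
the line is the first axis, `g` is balanced. -/
theorem exists_tilt (hS : Santalo d) {g : ℝ × (Fin d → ℝ) → ℝ≥0∞} (hg : Measurable g)
    (hfin : ∫⁻ p, g p ≠ ⊤) (h1 : Integrable (fun p => p.1) (volume.withDensity g))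
    (h2 : Integrable (fun p => p.2) (volume.withDensity g)) :
    ∃ ζ, ∀ (f : ℝ × (Fin d → ℝ) → ℝ≥0∞) (c : ℝ≥0∞), Measurable f →
      (∀ x y, f x * g y ≤ c * ENNReal.ofReal (Real.exp (-pairing x y))) →
      (∫⁻ x, f x * ENNReal.ofReal (Real.exp (pairing x ζ))) * (∫⁻ y, g y)
        ≤ c * (4 * halfMoment 0 ^ 2) ^ (d + 1) := by
  rcases eq_or_ne (∫⁻ p, g p) 0 with hz | hz
  · exact ⟨0, fun f c _ _ => by simp [hz]⟩
  set ν : Measure (ℝ × (Fin d → ℝ)) := volume.withDensity g with hν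
  have : IsFiniteMeasure ν := isFiniteMeasure_withDensity hfin
  have : NullSingletonClass (ν.map Prod.fst) := ⟨fun t => by
    rw [Measure.map_apply measurable_fst (measurableSet_singleton t)]
    refine withDensity_absolutelyContinuous _ _ ?_
    rw [← prod_univ, Measure.volume_eq_prod, Measure.prod_prod]
    simp⟩
  obtain ⟨τ, hτ⟩ := exists_measure_Iio_eq_measure_Ioi (ν.map Prod.fst)
  rw [Measure.map_apply measurable_fst measurableSet_Iio,
    Measure.map_apply measurable_fst measurableSet_Ioi, ← prod_univ, ← prod_univ] at hτ
  set gp : ℝ × (Fin d → ℝ) → ℝ≥0∞ := fun p => g (τ + p.1, p.2)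
  set gm : ℝ × (Fin d → ℝ) → ℝ≥0∞ := fun p => g (τ - p.1, p.2)
  have hgp : Measurable gp := by fun_prop
  have hgm : Measurable gm := by fun_prop
  set μp := (halfVolume d).withDensity gp with hμp
  set μm := (halfVolume d).withDensity gm with hμm
  have mp := map_halfVolume_withDensity (d := d) (measurePreserving_add_left volume τ)
    (I := Ioi τ) measurableSet_Ioi (by ext; simp) hg
  have mm := map_halfVolume_withDensity (d := d)
    (Measure.measurePreserving_sub_left volume τ)
    (I := Iio τ) measurableSet_Iio (by ext; simp) hg
  have massp : μp univ = ν (Ioi τ ×ˢ univ) := by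
    have := congrArg (fun m => m univ) mp
    simpa [Measure.map_apply (show Measurable fun p : ℝ × (Fin d → ℝ) => (τ + p.1, p.2) by fun_prop)
      MeasurableSet.univ, hμp, hν, gp] using this
  have massm : μm univ = ν (Iio τ ×ˢ univ) := by
    have := congrArg (fun m => m univ) mm
    simpa [Measure.map_apply (show Measurable fun p : ℝ × (Fin d → ℝ) => (τ - p.1, p.2) by fun_prop)
      MeasurableSet.univ, hμm, hν, gm] using this
  have hmass : μm univ = μp univ := by rw [massp, massm, hτ]
  have : IsFiniteMeasure μp := ⟨by rw [massp]; exact measure_lt_top _ _⟩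
  have : IsFiniteMeasure μm := ⟨by rw [massm]; exact measure_lt_top _ _⟩
  have ip1 : Integrable (fun p => p.1) μp := by
    have := ((h1.sub (integrable_const τ)).restrict (s := Ioi τ ×ˢ univ))
    rw [← mp] at this
    simpa [Function.comp_def, hμp, gp] using this.comp_measurable (by fun_prop)
  have im1 : Integrable (fun p => p.1) μm := by
    have := (((integrable_const τ).sub h1).restrict (s := Iio τ ×ˢ univ))
    rw [← mm] at this
    simpa [Function.comp_def, hμm, gm] using this.comp_measurable (by fun_prop)
  have ip2 : Integrable (fun p => p.2) μp := by
    have := (h2.restrict (s := Ioi τ ×ˢ univ))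
    rw [← mp] at this
    exact this.comp_measurable (by fun_prop)
  have im2 : Integrable (fun p => p.2) μm := by
    have := (h2.restrict (s := Iio τ ×ˢ univ))
    rw [← mm] at this
    exact this.comp_measurable (by fun_prop)
  have hΦ := measurePreserving_affine_shear (d := d) τ
  have hμp0 : μp univ ≠ 0 := by
    intro h0
    have e1 := (measurePreserving_affine_shear (d := d) τ 0 0).lintegral_comp hg
    rw [lintegral_eq_halfVolume_add (by fun_prop)] at e1
    have e2 : ∫⁻ p, gp p ∂halfVolume d = 0 := by simpa [hμp] using h0
    have e3 : ∫⁻ p, gm p ∂halfVolume d = 0 := by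
      rw [← hmass] at h0
      simpa [hμm] using h0
    simp only [zero_add, smul_zero, add_zero, ← sub_eq_add_neg] at e1
    rw [e2, e3, zero_add] at e1
    exact hz e1.symm
  have Tp := integral_fst_pos (withDensity_absolutelyContinuous _ gp)
    (fun h => hμp0 (by rw [hμp, h]; simp)) ip1
  have Tm := integral_fst_pos (withDensity_absolutelyContinuous _ gm)
    (fun h => hμp0 (by rw [← hmass, hμm, h]; simp)) im1
  rw [← hμp] at Tp
  rw [← hμm] at Tm
  set tp := ∫ p, p.1 ∂μp
  set tm := ∫ p, p.1 ∂μm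
  set yp := ∫ p, p.2 ∂μp
  set ym := ∫ p, p.2 ∂μm with hym
  set r := μp.real univ with hr
  have hr0 : r ≠ 0 := (measureReal_ne_zero_iff (measure_ne_top _ _)).2 hμp0
  have hrm : μm.real univ = r := by rw [hr, measureReal_def, measureReal_def, hmass]
  set v : Fin d → ℝ := (tp + tm)⁻¹ • (yp - ym)
  set z : Fin d → ℝ := r⁻¹ • (yp - tp • v)
  have hrz : r • z = yp - tp • v := smul_inv_smul₀ hr0 _
  have hvv : (tp + tm) • v = yp - ym := smul_inv_smul₀ (by positivity) _
  have cp := centered_shear (z := z) (v := v) hgp hμp ip1 ip2 (by rw [← hr, hrz]; abel)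
  have cm := centered_shear (z := z) (v := -v) hgm hμm im1 im2 (by
    rw [hrm, hrz, ← hym]
    have : ym = yp - (tp + tm) • v := by rw [hvv]; abel
    rw [this, add_smul, smul_neg]
    abel)
  refine ⟨(τ, z), fun f c hf h => ?_⟩
  have hbal := lintegral_mul_le_of_balanced hS (c := c)
    (f := fun x => f (dualShear v x) * ENNReal.ofReal (Real.exp (pairing (dualShear v x) (τ, z))))
    (g := fun y => g (τ + y.1, z + y.2 + y.1 • v)) (by fun_prop) (by fun_prop) ?_ ?_ ?_ cp ?_
  · rw [(measurePreserving_dualShear v).lintegral_comp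
      (f := fun x => f x * ENNReal.ofReal (Real.exp (pairing x (τ, z)))) (by fun_prop),
      (hΦ z v).lintegral_comp hg] at hbal
    exact hbal
  · intro x y
    rw [mul_right_comm]
    refine (mul_le_mul_left (h _ _) _).trans_eq ?_
    rw [mul_assoc, ← ENNReal.ofReal_mul (by positivity), ← Real.exp_add,
      pairing_dualShear_affine_shear]
    congr 3
    ring
  · have := (measurePreserving_shear z v).lintegral_comp hgp
    simp only [gp, shear] at this
    rw [this]
    have h3 := measure_ne_top μp univ
    simpa [hμp] using h3
  · have e1 := (measurePreserving_shear z v).lintegral_comp hgp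
    have e2 := (measurePreserving_shear z (-v)).lintegral_comp hgm
    simp only [gp, gm, shear] at e1 e2
    rw [e1]
    simp only [smul_neg, ← neg_smul, sub_eq_add_neg] at e2
    rw [e2]
    simpa [hμp, hμm, gp, gm, sub_eq_add_neg] using hmass
  · have e : (fun y : ℝ × (Fin d → ℝ) => g (τ + -y.1, z + y.2 + -y.1 • v))
        = fun p => gm (shear z (-v) p) := by
      ext1 p
      simp only [gm, shear, smul_neg, ← neg_smul, sub_eq_add_neg]
    rw [e]
    exact cm

/-- Tilting by an exponential does not decrease the integral of a function with barycenter at the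
origin, because `eᵃ ≥ 1 + a`. -/
theorem lintegral_le_lintegral_tilt {X : Type*} [MeasurableSpace X] {μ : Measure X}
    [IsFiniteMeasure μ] {a : X → ℝ} (ha : Integrable a μ) (h0 : ∫ x, a x ∂μ = 0) :
    μ univ ≤ ∫⁻ x, ENNReal.ofReal (Real.exp (a x)) ∂μ := by
  calc μ univ = ENNReal.ofReal (∫ x, (1 + a x) ∂μ) := by
        rw [integral_add (integrable_const _) ha, h0]
        simp
    _ ≤ ENNReal.ofReal (∫ x, max (1 + a x) 0 ∂μ) :=
        ENNReal.ofReal_le_ofReal (integral_mono ((integrable_const _).add ha)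
          ((integrable_const _).add ha).pos_part fun x => le_max_left _ _)
    _ = ∫⁻ x, ENNReal.ofReal (max (1 + a x) 0) ∂μ :=
        ofReal_integral_eq_lintegral_ofReal ((integrable_const _).add ha).pos_part
          (ae_of_all _ fun x => le_max_right _ _)
    _ ≤ _ := by
        refine lintegral_mono fun x => ENNReal.ofReal_le_ofReal (max_le ?_ (Real.exp_pos _).le)
        linarith [Real.add_one_le_exp (a x)]

/-- The Santaló inequality on `ℝ × ℝᵈ` for a function `f` with barycenter at the origin. -/
theorem lintegral_mul_le_of_centered (hS : Santalo d) {f g : ℝ × (Fin d → ℝ) → ℝ≥0∞}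
    (hf : Measurable f) (hg : Measurable g) {c : ℝ≥0∞}
    (h : ∀ x y, f x * g y ≤ c * ENNReal.ofReal (Real.exp (-pairing x y)))
    (hfin : ∫⁻ x, f x ≠ ⊤)
    (hcen : ∀ ζ, Integrable (fun x => pairing x ζ) (volume.withDensity f) ∧
      ∫ x, pairing x ζ ∂(volume.withDensity f) = 0) :
    (∫⁻ x, f x) * (∫⁻ y, g y) ≤ c * (4 * halfMoment 0 ^ 2) ^ (d + 1) := by
  -- bounded truncations of `g` with bounded support have a mass and a barycenter
  set gk : ℕ → ℝ × (Fin d → ℝ) → ℝ≥0∞ := fun k =>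
    (closedBall 0 (k : ℝ)).indicator fun p => min (g p) k with hgk
  have hgkm : ∀ k, Measurable (gk k) := fun k => by
    refine Measurable.indicator (by fun_prop) isClosed_closedBall.measurableSet
  have hle : ∀ k p, gk k p ≤ g p := fun k p =>
    indicator_apply_le' (fun _ => min_le_left _ _) fun _ => zero_le
  have hmono : Monotone gk := by
    intro k l hkl p
    refine indicator_apply_le' (fun hp => ?_) fun _ => zero_le
    rw [hgk]
    simp only
    rw [indicator_of_mem (closedBall_subset_closedBall (by exact_mod_cast hkl) hp)]
    exact min_le_min le_rfl (by exact_mod_cast hkl)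
  have hsup : ∫⁻ p, g p = ⨆ k, ∫⁻ p, gk k p := by
    rw [← lintegral_iSup hgkm hmono]
    congr 1 with p
    refine le_antisymm ?_ (iSup_le fun k => hle k p)
    refine le_of_forall_lt fun a ha => ?_
    obtain ⟨k, hk⟩ := exists_nat_ge ‖p‖
    obtain ⟨l, hl⟩ := ENNReal.exists_nat_gt (ha.trans_le le_top).ne
    refine lt_of_lt_of_le ?_ (le_iSup _ (max k l))
    rw [hgk]
    simp only
    rw [indicator_of_mem (by
      rw [mem_closedBall_zero_iff]
      exact hk.trans (by exact_mod_cast le_max_left k l))]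
    exact lt_min ha (hl.trans_le (by exact_mod_cast le_max_right k l))
  have : IsFiniteMeasure (volume.withDensity f) := isFiniteMeasure_withDensity hfin
  rw [hsup, ENNReal.mul_iSup]
  refine iSup_le fun k => ?_
  have hkfin : ∫⁻ p, gk k p ≠ ⊤ := by
    rw [hgk, lintegral_indicator isClosed_closedBall.measurableSet]
    refine ne_top_of_le_ne_top ?_ (setLIntegral_mono' isClosed_closedBall.measurableSet
      (g := fun _ => (k : ℝ≥0∞)) fun p _ => min_le_right _ _)
    rw [setLIntegral_const]
    exact ENNReal.mul_ne_top (by simp) measure_closedBall_lt_top.ne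
  have : IsFiniteMeasure (volume.withDensity (gk k)) := isFiniteMeasure_withDensity hkfin
  have hae : ∀ᵐ p ∂(volume.withDensity (gk k)), ‖p‖ ≤ k := by
    rw [ae_withDensity_iff (hgkm k)]
    refine ae_of_all _ fun p hp => ?_
    by_contra hcon
    exact hp (indicator_of_notMem (by rwa [mem_closedBall_zero_iff]) _)
  obtain ⟨ζ, hζ⟩ := exists_tilt hS (hgkm k) hkfin
    (Integrable.of_bound (by fun_prop) k (hae.mono fun p hp => (norm_fst_le p).trans hp))
    (Integrable.of_bound (by fun_prop) k (hae.mono fun p hp => (norm_snd_le p).trans hp))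
  -- the tilt by `ζ` is only applied to `f`, whose barycenter is at the origin
  refine le_trans ?_ (hζ f c hf fun x y => (mul_le_mul_right (hle k y) _).trans (h x y))
  refine mul_le_mul_left ?_ _
  have := lintegral_le_lintegral_tilt (hcen ζ).1 (hcen ζ).2
  rw [lintegral_withDensity_eq_lintegral_mul _ hf (by fun_prop)] at this
  simpa using this

theorem santalo_succ (hS : Santalo d) : Santalo (d + 1) := by
  intro f g c hf hg h hfin hcen
  set e := MeasurableEquiv.piFinSuccAbove (fun _ : Fin (d + 1) => ℝ) 0
  have he : MeasurePreserving e volume volume := volume_preserving_piFinSuccAbove (fun _ => ℝ) 0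
  have hpair : ∀ x y : Fin (d + 1) → ℝ, pairing (e x) (e y) = x ⬝ᵥ y := by
    intro x y
    simp only [pairing, dotProduct, Fin.sum_univ_succ]
    rfl
  have hes : ∀ k : (Fin (d + 1) → ℝ) → ℝ≥0∞, ∫⁻ p, k (e.symm p) = ∫⁻ x, k x := fun k => by
    rw [← he.map_eq, lintegral_map_equiv]
    simp
  have hmap : (volume.withDensity f).map e = volume.withDensity fun p => f (e.symm p) := by
    refine Measure.ext_of_lintegral _ fun φ hφ => ?_
    rw [lintegral_map_equiv, lintegral_withDensity_eq_lintegral_mul _ hf (by fun_prop),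
      lintegral_withDensity_eq_lintegral_mul _ (by fun_prop) hφ, ← hes]
    simp
  have := lintegral_mul_le_of_centered hS (f := fun p => f (e.symm p)) (g := fun p => g (e.symm p))
    (c := c) (by fun_prop) (by fun_prop) (fun p q => by
      rw [← e.apply_symm_apply p, ← e.apply_symm_apply q, hpair]
      simpa using h _ _) (by rwa [hes]) (fun ζ => by
      have hm : Measurable fun x => pairing x ζ := by fun_prop
      rw [← hmap, integrable_map_measure hm.aestronglyMeasurable e.measurable.aemeasurable,
        integral_map e.measurable.aemeasurable hm.aestronglyMeasurable]
      have : ∀ x, pairing (e x) ζ = x ⬝ᵥ e.symm ζ := fun x => by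
        rw [← hpair, e.apply_symm_apply]
      simp only [Function.comp_def, this]
      exact hcen _)
  rwa [hes, hes] at this

theorem santalo (d : ℕ) : Santalo d := by
  induction d with
  | zero => exact santalo_zero
  | succ d ih => exact santalo_succ ih

/-- For every `g` there is a shear, which makes the barycenter of `t² g` on the half-space `t > 0`
lie on the first axis, such that the Santaló inequality with weight `t²` holds on half-spaces
for all `f`. -/
theorem exists_shear_lintegral_mul_le {g : ℝ × (Fin d → ℝ) → ℝ≥0∞} (hg : Measurable g)
    (hfin : ∫⁻ y, ENNReal.ofReal (y.1 ^ 2) * g y ∂halfVolume d ≠ ⊤)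
    (h1 : Integrable (fun p => p.1)
      ((halfVolume d).withDensity fun y => ENNReal.ofReal (y.1 ^ 2) * g y))
    (h2 : Integrable (fun p => p.2)
      ((halfVolume d).withDensity fun y => ENNReal.ofReal (y.1 ^ 2) * g y)) :
    ∃ v : Fin d → ℝ, ∀ (f : ℝ × (Fin d → ℝ) → ℝ≥0∞), Measurable f →
      (∀ x y, 0 < x.1 → 0 < y.1 →
        f x * g (shear 0 v y) ≤ ENNReal.ofReal (Real.exp (-pairing x y))) →
      (∫⁻ x, ENNReal.ofReal (x.1 ^ 2) * f x ∂halfVolume d)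
          * (∫⁻ y, ENNReal.ofReal (y.1 ^ 2) * g y ∂halfVolume d)
        ≤ halfMoment 2 ^ 2 * (4 * halfMoment 0 ^ 2) ^ d := by
  set k : ℝ × (Fin d → ℝ) → ℝ≥0∞ := fun y => ENNReal.ofReal (y.1 ^ 2) * g y
  have hkm : Measurable k := by fun_prop
  set μ := (halfVolume d).withDensity k with hμ
  have : IsFiniteMeasure μ := isFiniteMeasure_withDensity hfin
  rcases eq_or_ne μ 0 with h0 | h0
  · have hz : ∫⁻ y, k y ∂halfVolume d = 0 := by
      have : μ univ = 0 := by simp [h0]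
      simpa [hμ] using this
    exact ⟨0, fun f _ _ => by rw [hz]; simp⟩
  have hT := integral_fst_pos (withDensity_absolutelyContinuous _ k) h0 h1
  rw [← hμ] at hT
  set v : Fin d → ℝ := (∫ p, p.1 ∂μ)⁻¹ • ∫ p, p.2 ∂μ with hv
  have hcen := centered_shear (z := 0) (v := v) hkm hμ h1 h2 (by
    rw [hv, smul_inv_smul₀ hT.ne', smul_zero, zero_add])
  have hint := (measurePreserving_shear 0 v).lintegral_comp hkm
  refine ⟨v, fun f hf h => ?_⟩
  have := lintegral_halfVolume_mul_le (santalo d) 2 hf (g := fun y => g (shear 0 v y)) (c := 1)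
    (by fun_prop) (by simpa using h) (hint.trans_ne hfin) hcen
  rw [one_mul] at this
  rw [← hint]
  exact this

end

section

variable {d n : ℕ}

/-! ### Symmetric convex bodies and their gauges -/

/-- An origin-symmetric convex body in `ℝⁿ`; the origin is then an interior point. -/
structure IsSymmBody (K : Set (EuclideanSpace ℝ (Fin n))) : Prop where
  convex : Convex ℝ K
  isCompact : IsCompact K
  neg_mem : ∀ x ∈ K, -x ∈ K
  mem_nhds : K ∈ 𝓝 0

namespace IsSymmBody

variable {K : Set (EuclideanSpace ℝ (Fin n))}

theorem of_interior_nonempty (h1 : Convex ℝ K) (h2 : IsCompact K) (h3 : (interior K).Nonempty)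
    (h4 : ∀ x, x ∈ K ↔ -x ∈ K) : IsSymmBody K := by
  refine ⟨h1, h2, fun x hx => (h4 x).1 hx, mem_interior_iff_mem_nhds.1 ?_⟩
  obtain ⟨x, hx⟩ := h3
  have hK : -K = K := by
    ext y
    rw [Set.mem_neg, ← h4]
  have hx' : -x ∈ interior K := by
    have := (Homeomorph.neg (EuclideanSpace ℝ (Fin n))).image_interior K
    simp only [Homeomorph.coe_neg, image_neg_eq_neg, hK] at this
    rw [← this, Set.mem_neg, neg_neg]
    exact hx
  have := h1.interior hx hx' (show (0 : ℝ) ≤ 1 / 2 by norm_num) (show (0 : ℝ) ≤ 1 / 2 by norm_num)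
    (by norm_num)
  simpa using this

theorem closedBall_zero_one : IsSymmBody (closedBall (0 : EuclideanSpace ℝ (Fin n)) 1) :=
  ⟨convex_closedBall _ _, isCompact_closedBall _ _, fun x hx => by simpa using hx,
    closedBall_mem_nhds _ one_pos⟩

theorem zero_mem (hK : IsSymmBody K) : (0 : EuclideanSpace ℝ (Fin n)) ∈ K :=
  mem_of_mem_nhds hK.mem_nhds

theorem polarBody (hK : IsSymmBody K) : IsSymmBody (polarBody K) := by
  have hclosed : IsClosed (_root_.polarBody K) := by
    have : _root_.polarBody K = ⋂ y ∈ K, {x | inner ℝ x y ≤ 1} := by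
      ext x
      simp [_root_.polarBody]
    rw [this]
    exact isClosed_biInter fun y _ => isClosed_le (by fun_prop) continuous_const
  refine ⟨?_, ?_, ?_, ?_⟩
  · intro x hx y hy a b ha hb hab z hz
    rw [inner_add_left, real_inner_smul_left, real_inner_smul_left]
    nlinarith [hx z hz, hy z hz]
  · obtain ⟨r, hr, hrK⟩ := Metric.mem_nhds_iff.1 hK.mem_nhds
    refine (isCompact_closedBall 0 (2 / r)).of_isClosed_subset hclosed fun x hx => ?_
    rw [mem_closedBall_zero_iff]
    rcases eq_or_ne x 0 with rfl | hx0
    · rw [norm_zero]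
      positivity
    have hxn : 0 < ‖x‖ := norm_pos_iff.2 hx0
    have hmem : (r / 2 * ‖x‖⁻¹) • x ∈ K := hrK (by
      rw [mem_ball_zero_iff, norm_smul, norm_mul, norm_inv, norm_norm,
        Real.norm_of_nonneg (by positivity), mul_assoc, inv_mul_cancel₀ hxn.ne']
      linarith)
    have := hx _ hmem
    rw [real_inner_smul_right, real_inner_self_eq_norm_sq] at this
    rw [le_div_iff₀ hr]
    field_simp at this
    linarith
  · intro x hx y hy
    have := hx (-y) (hK.neg_mem y hy)
    rwa [inner_neg_right, ← inner_neg_left] at this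
  · obtain ⟨R, hR, hRK⟩ := hK.isCompact.isBounded.subset_closedBall_lt 0 0
    refine Filter.mem_of_superset (ball_mem_nhds 0 (inv_pos.2 hR)) fun x hx y hy => ?_
    rw [mem_ball_zero_iff] at hx
    have hy' := mem_closedBall_zero_iff.1 (hRK hy)
    calc inner ℝ x y ≤ ‖x‖ * ‖y‖ := real_inner_le_norm _ _
      _ ≤ R⁻¹ * R := by gcongr
      _ = 1 := inv_mul_cancel₀ hR.ne'

theorem absorbent (hK : IsSymmBody K) : Absorbent ℝ K := absorbent_nhds_zero hK.mem_nhds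

theorem continuous_gauge (hK : IsSymmBody K) : Continuous (gauge K) :=
  _root_.continuous_gauge hK.convex hK.mem_nhds

theorem gauge_le_one_iff (hK : IsSymmBody K) {x : EuclideanSpace ℝ (Fin n)} :
    gauge K x ≤ 1 ↔ x ∈ K := by
  rw [gauge_le_one_iff_mem_closure hK.convex hK.mem_nhds, hK.isCompact.isClosed.closure_eq]

theorem gauge_neg (hK : IsSymmBody K) (x : EuclideanSpace ℝ (Fin n)) : gauge K (-x) = gauge K x :=
  _root_.gauge_neg hK.neg_mem x

theorem gauge_pos (hK : IsSymmBody K) {x : EuclideanSpace ℝ (Fin n)} (hx : x ≠ 0) : 0 < gauge K x :=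
  (_root_.gauge_pos hK.absorbent
    (NormedSpace.isVonNBounded_of_isBounded ℝ hK.isCompact.isBounded)).2 hx

theorem gauge_smul_of_pos {r : ℝ} (hr : 0 < r) (x : EuclideanSpace ℝ (Fin n)) :
    gauge K (r • x) = r * gauge K x := by
  rw [gauge_smul_of_nonneg hr.le, smul_eq_mul]

theorem inner_le_gauge_mul_gauge (hK : IsSymmBody K) (x y : EuclideanSpace ℝ (Fin n)) :
    inner ℝ x y ≤ gauge K x * gauge (_root_.polarBody K) y := by
  rcases eq_or_ne x 0 with rfl | hx
  · simp [gauge_zero]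
  rcases eq_or_ne y 0 with rfl | hy
  · simp [gauge_zero]
  have hx' := hK.gauge_pos hx
  have hy' := hK.polarBody.gauge_pos hy
  have h1 : (gauge K x)⁻¹ • x ∈ K := by
    rw [← hK.gauge_le_one_iff, gauge_smul_of_pos (inv_pos.2 hx'), inv_mul_cancel₀ hx'.ne']
  have h2 : (gauge (_root_.polarBody K) y)⁻¹ • y ∈ _root_.polarBody K := by
    rw [← hK.polarBody.gauge_le_one_iff, gauge_smul_of_pos (inv_pos.2 hy'),
      inv_mul_cancel₀ hy'.ne']
  have := h2 _ h1
  rw [real_inner_smul_left, real_inner_smul_right, real_inner_comm] at this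
  field_simp at this
  linarith

/-- The Gaussian-type functions of a body and of its polar body are in Santaló duality. -/
theorem exp_gauge_mul_exp_gauge_le (hK : IsSymmBody K) (x y : EuclideanSpace ℝ (Fin n)) :
    ENNReal.ofReal (Real.exp (-(gauge K x ^ 2 / 2)))
        * ENNReal.ofReal (Real.exp (-(gauge (_root_.polarBody K) y ^ 2 / 2)))
      ≤ ENNReal.ofReal (Real.exp (-inner ℝ x y)) := by
  rw [← ENNReal.ofReal_mul (Real.exp_pos _).le, ← Real.exp_add]
  refine ENNReal.ofReal_le_ofReal (Real.exp_le_exp.2 ?_)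
  nlinarith [hK.inner_le_gauge_mul_gauge x y,
    sq_nonneg (gauge K x - gauge (_root_.polarBody K) y)]

end IsSymmBody

/-- The layer-cake representation of `e^{-r²/2}`. -/
theorem exp_eq_lintegral_Ioi {r : ℝ} (hr : 0 ≤ r) :
    ENNReal.ofReal (Real.exp (-(r ^ 2 / 2))) = ∫⁻ ρ in Ioi 0,
      (Ioi r).indicator (fun ρ => ENNReal.ofReal (ρ * Real.exp (-(ρ ^ 2 / 2)))) ρ := by
  rw [setLIntegral_indicator measurableSet_Ioi, inter_eq_left.2 (Ioi_subset_Ioi hr)]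
  have hd : ∀ x ∈ Ici r, HasDerivAt (fun x : ℝ => -Real.exp (-(x ^ 2 / 2)))
      (x * Real.exp (-(x ^ 2 / 2))) x := by
    intro x _
    have h1 : HasDerivAt (fun x : ℝ => -(x ^ 2 / 2)) (-x) x := by
      have := ((hasDerivAt_pow 2 x).div_const 2).neg
      convert! this using 1
      simp
    have := h1.exp.neg
    convert! this using 1
    ring
  have hpos : ∀ x ∈ Ioi r, 0 ≤ x * Real.exp (-(x ^ 2 / 2)) := fun x hx =>
    mul_nonneg (hr.trans (le_of_lt hx)) (Real.exp_pos _).le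
  have ht : Tendsto (fun x : ℝ => -Real.exp (-(x ^ 2 / 2))) atTop (𝓝 (-0)) := by
    refine (Real.tendsto_exp_atBot.comp (tendsto_neg_atTop_atBot.comp ?_)).neg
    exact (tendsto_pow_atTop two_ne_zero).atTop_div_const two_pos
  have hi := integrableOn_Ioi_deriv_of_nonneg' hd hpos ht
  have hI := integral_Ioi_of_hasDerivAt_of_tendsto' hd hi ht
  rw [← ofReal_integral_eq_lintegral_ofReal hi
    ((ae_restrict_iff' measurableSet_Ioi).2 (ae_of_all _ hpos)), hI]
  simp

theorem lintegral_smul_eq (F : EuclideanSpace ℝ (Fin n) → ℝ≥0∞) (hF : Measurable F) {r : ℝ}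
    (hr : 0 < r) : ∫⁻ x, F x = ENNReal.ofReal (r ^ n) * ∫⁻ x, F (r • x) := by
  have h := Measure.map_addHaar_smul (volume : Measure (EuclideanSpace ℝ (Fin n))) hr.ne'
  rw [finrank_euclideanSpace_fin] at h
  have h2 := lintegral_map (μ := volume) hF (measurable_const_smul r)
  rw [← h2, h, lintegral_smul_measure, smul_eq_mul, ← mul_assoc,
    ← ENNReal.ofReal_mul (by positivity), abs_of_pos (by positivity),
    mul_inv_cancel₀ (by positivity)]
  simp

/-- Integrals over a body against a homogeneous weight, in terms of its Gaussian-type function. -/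
theorem IsSymmBody.lintegral_mul_exp_gauge {K : Set (EuclideanSpace ℝ (Fin n))}
    (hK : IsSymmBody K) {w : EuclideanSpace ℝ (Fin n) → ℝ≥0∞} (hw : Measurable w) {k : ℕ}
    (hom : ∀ r > 0, ∀ x, w (r • x) = ENNReal.ofReal (r ^ k) * w x) :
    ∫⁻ x, w x * ENNReal.ofReal (Real.exp (-(gauge K x ^ 2 / 2)))
      = halfMoment (n + k + 1) * ∫⁻ x in K, w x := by
  have hN := hK.continuous_gauge.measurable
  have hset : MeasurableSet {p : EuclideanSpace ℝ (Fin n) × ℝ | gauge K p.1 < p.2} :=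
    measurableSet_lt (by fun_prop) (by fun_prop)
  set φ : ℝ → ℝ≥0∞ := fun ρ => ENNReal.ofReal (ρ * Real.exp (-(ρ ^ 2 / 2))) with hφ
  have hφm : Measurable φ := by fun_prop
  have hball : ∀ ρ > 0, ∫⁻ x, w x * (Ioi (gauge K x)).indicator φ ρ
      = φ ρ * (ENNReal.ofReal (ρ ^ (n + k)) * ∫⁻ x in K, w x) := by
    intro ρ hρ
    have h1 : ∀ x, w x * (Ioi (gauge K x)).indicator φ ρ
        = φ ρ * {x | gauge K x < ρ}.indicator w x := by
      intro x
      by_cases hx : gauge K x < ρ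
      · rw [indicator_of_mem (show ρ ∈ Ioi (gauge K x) from hx),
          indicator_of_mem (show x ∈ {x | gauge K x < ρ} from hx), mul_comm]
      · rw [indicator_of_notMem (show ρ ∉ Ioi (gauge K x) from hx),
          indicator_of_notMem (show x ∉ {x | gauge K x < ρ} from hx)]
        simp
    have hms : ∀ ρ : ℝ, MeasurableSet {x | gauge K x < ρ} := fun ρ =>
      measurableSet_lt hN measurable_const
    simp only [h1]
    rw [lintegral_const_mul _ (hw.indicator (hms ρ))]
    congr 1
    rw [lintegral_smul_eq _ (hw.indicator (hms ρ)) hρ]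
    have h2 : ∀ x, {x | gauge K x < ρ}.indicator w (ρ • x)
        = ENNReal.ofReal (ρ ^ k) * {x | gauge K x < 1}.indicator w x := by
      intro x
      have : gauge K (ρ • x) < ρ ↔ gauge K x < 1 := by
        rw [IsSymmBody.gauge_smul_of_pos hρ]
        constructor
        · intro h
          nlinarith
        · intro h
          nlinarith
      by_cases hx : gauge K x < 1
      · rw [indicator_of_mem (show ρ • x ∈ {x | gauge K x < ρ} from this.2 hx),
          indicator_of_mem (show x ∈ {x | gauge K x < 1} from hx), hom ρ hρ]
      · rw [indicator_of_notMem (show ρ • x ∉ {x | gauge K x < ρ} from fun h => hx (this.1 h)),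
          indicator_of_notMem (show x ∉ {x | gauge K x < 1} from hx), mul_zero]
    simp only [h2]
    rw [lintegral_const_mul _ (hw.indicator (hms 1)), lintegral_indicator (hms 1), pow_add,
      ENNReal.ofReal_mul (by positivity), mul_assoc,
      setOfPred_gauge_lt_one_eq_interior hK.convex hK.mem_nhds,
      setLIntegral_congr (interior_ae_eq_of_null_frontier (hK.convex.addHaar_frontier volume))]
  have hjoint : Measurable (Function.uncurry fun (x : EuclideanSpace ℝ (Fin n)) (ρ : ℝ) =>
      w x * (Ioi (gauge K x)).indicator φ ρ) := by
    have : (Function.uncurry fun (x : EuclideanSpace ℝ (Fin n)) (ρ : ℝ) =>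
        w x * (Ioi (gauge K x)).indicator φ ρ)
        = fun p => w p.1 * {p : EuclideanSpace ℝ (Fin n) × ℝ | gauge K p.1 < p.2}.indicator
          (fun p => φ p.2) p := by
      ext p
      rfl
    rw [this]
    exact (by fun_prop : Measurable fun p : EuclideanSpace ℝ (Fin n) × ℝ => w p.1).mul
      ((by fun_prop : Measurable fun p : EuclideanSpace ℝ (Fin n) × ℝ => φ p.2).indicator hset)
  calc ∫⁻ x, w x * ENNReal.ofReal (Real.exp (-(gauge K x ^ 2 / 2)))
      = ∫⁻ x, ∫⁻ ρ in Ioi 0, w x * (Ioi (gauge K x)).indicator φ ρ := by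
        congr 1 with x
        rw [lintegral_const_mul _ (hφm.indicator measurableSet_Ioi),
          exp_eq_lintegral_Ioi (gauge_nonneg x)]
    _ = ∫⁻ ρ in Ioi 0, ∫⁻ x, w x * (Ioi (gauge K x)).indicator φ ρ :=
        lintegral_lintegral_swap hjoint.aemeasurable
    _ = ∫⁻ ρ in Ioi 0, ENNReal.ofReal (ρ ^ (n + k + 1) * Real.exp (-(ρ ^ 2 / 2)))
          * ∫⁻ x in K, w x := by
        refine setLIntegral_congr_fun measurableSet_Ioi fun ρ (hρ : 0 < ρ) => ?_
        rw [hball ρ hρ, ← mul_assoc, hφ, ← ENNReal.ofReal_mul (by positivity)]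
        congr 2
        ring
    _ = _ := by
        rw [lintegral_mul_const _ (by fun_prop)]
        rfl

/-! ### Coordinates adapted to a direction -/

/-- The coordinates `ℝ × ℝᵈ → ℝᵈ⁺¹` given by an orthonormal basis, the first vector of which is
singled out. -/
noncomputable def coords (b : OrthonormalBasis (Fin (d + 1)) ℝ (EuclideanSpace ℝ (Fin (d + 1))))
    (p : ℝ × (Fin d → ℝ)) : EuclideanSpace ℝ (Fin (d + 1)) :=
  p.1 • b 0 + ∑ i, p.2 i • b i.succ

variable (b : OrthonormalBasis (Fin (d + 1)) ℝ (EuclideanSpace ℝ (Fin (d + 1))))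

@[fun_prop]
theorem continuous_coords : Continuous (coords b) := by
  unfold coords
  fun_prop

@[fun_prop]
theorem measurable_coords : Measurable (coords b) := (continuous_coords b).measurable

theorem coords_eq_repr_symm (p : ℝ × (Fin d → ℝ)) :
    coords b p = b.repr.symm (WithLp.toLp 2 (Fin.cons p.1 p.2)) := by
  rw [← b.sum_repr_symm, Fin.sum_univ_succ]
  rfl

theorem measurePreserving_coords : MeasurePreserving (coords b) volume volume := by
  have h1 := b.measurePreserving_repr_symm
  have h2 := (PiLp.volume_preserving_toLp (Fin (d + 1)))
  have h3 := (volume_preserving_piFinSuccAbove (fun _ : Fin (d + 1) => ℝ) 0).symm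
  have := (h1.comp h2).comp h3
  convert! this using 1
  ext1 p
  rw [coords_eq_repr_symm]
  simp [MeasurableEquiv.piFinSuccAbove]
  rfl

theorem inner_coords (p q : ℝ × (Fin d → ℝ)) :
    inner ℝ (coords b p) (coords b q) = pairing p q := by
  rw [coords_eq_repr_symm, coords_eq_repr_symm, LinearIsometryEquiv.inner_map_map]
  simp [pairing, PiLp.inner_apply, Fin.sum_univ_succ, dotProduct, mul_comm]

theorem coords_surjective : Function.Surjective (coords b) := by
  intro x
  refine ⟨(b.repr x 0, fun i => b.repr x i.succ), ?_⟩
  rw [coords_eq_repr_symm, LinearIsometryEquiv.symm_apply_eq]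
  ext i
  refine Fin.cases ?_ (fun j => ?_) i <;> simp

theorem coords_one_zero : coords b (1, 0) = b 0 := by simp [coords]

theorem coords_neg (p : ℝ × (Fin d → ℝ)) : coords b (-p) = -coords b p := by
  simp only [coords, Prod.fst_neg, Prod.snd_neg, Pi.neg_apply, neg_smul, Finset.sum_neg_distrib,
    neg_add]

theorem norm_coords_sq (p : ℝ × (Fin d → ℝ)) : ‖coords b p‖ ^ 2 = p.1 ^ 2 + ∑ i, p.2 i ^ 2 := by
  rw [← real_inner_self_eq_norm_sq, inner_coords]
  simp [pairing, dotProduct, pow_two]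

theorem abs_fst_le_norm_coords (p : ℝ × (Fin d → ℝ)) : |p.1| ≤ ‖coords b p‖ := by
  refine abs_le_of_sq_le_sq ?_ (norm_nonneg _)
  rw [norm_coords_sq]
  exact le_add_of_nonneg_right (Finset.sum_nonneg fun i _ => sq_nonneg _)

theorem norm_snd_le_norm_coords (p : ℝ × (Fin d → ℝ)) : ‖p.2‖ ≤ ‖coords b p‖ := by
  refine (pi_norm_le_iff_of_nonneg (norm_nonneg _)).2 fun i => ?_
  rw [Real.norm_eq_abs]
  refine abs_le_of_sq_le_sq ?_ (norm_nonneg _)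
  rw [norm_coords_sq]
  exact le_add_of_nonneg_of_le (sq_nonneg _)
    (Finset.single_le_sum (f := fun i => p.2 i ^ 2) (fun i _ => sq_nonneg _) (Finset.mem_univ i))

/-! ### The Gaussian value -/

theorem lintegral_eq_two_mul_of_even {F : ℝ → ℝ≥0∞} (hF : ∀ s, F (-s) = F s) :
    ∫⁻ s, F s = 2 * ∫⁻ s in Ioi 0, F s := by
  have h1 : ∫⁻ s in Ioi (0 : ℝ), F s = ∫⁻ s in Iio (0 : ℝ), F s := by
    have := (Measure.measurePreserving_neg (volume : Measure ℝ)).setLIntegral_comp_preimage_emb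
      (Homeomorph.neg ℝ).measurableEmbedding F (Iio 0)
    rw [← this]
    simp [hF]
  rw [← setLIntegral_univ, ← Iic_union_Ioi (a := (0 : ℝ)), lintegral_union measurableSet_Ioi (by
      rw [disjoint_left]; intro y (h : y ≤ 0) (h' : 0 < y); linarith),
    ← setLIntegral_congr (Iio_ae_eq_Iic (a := (0 : ℝ))), ← h1, two_mul]

theorem lintegral_pow_mul_gaussian {k : ℕ} (hk : Even k) :
    ∫⁻ z : ℝ, ENNReal.ofReal (z ^ k * Real.exp (-(z ^ 2 / 2))) = 2 * halfMoment k :=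
  lintegral_eq_two_mul_of_even fun s => by rw [hk.neg_pow, even_two.neg_pow]

theorem lintegral_pow_mul_gaussian_prod {k : ℕ} (hk : Even k) :
    ∫⁻ p : ℝ × (Fin d → ℝ), ENNReal.ofReal (p.1 ^ k * Real.exp (-(p.1 ^ 2 / 2)))
        * ENNReal.ofReal (Real.exp (-((∑ i, p.2 i ^ 2) / 2)))
      = 2 * halfMoment k
        * ∫⁻ x : Fin d → ℝ, ENNReal.ofReal (Real.exp (-((∑ i, x i ^ 2) / 2))) := by
  rw [← lintegral_pow_mul_gaussian hk, Measure.volume_eq_prod]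
  exact lintegral_prod_mul (f := fun z : ℝ => ENNReal.ofReal (z ^ k * Real.exp (-(z ^ 2 / 2))))
    (g := fun x : Fin d → ℝ => ENNReal.ofReal (Real.exp (-((∑ i, x i ^ 2) / 2))))
    (Measurable.aemeasurable (by fun_prop)) (Measurable.aemeasurable (by fun_prop))

theorem lintegral_gaussian_pi : ∀ d : ℕ,
    ∫⁻ x : Fin d → ℝ, ENNReal.ofReal (Real.exp (-((∑ i, x i ^ 2) / 2))) = (2 * halfMoment 0) ^ d
  | 0 => by
    rw [Measure.volume_pi_eq_dirac 0, lintegral_dirac]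
    simp
  | d + 1 => by
    have he := (volume_preserving_piFinSuccAbove (fun _ : Fin (d + 1) => ℝ) 0)
    set F : ℝ × (Fin d → ℝ) → ℝ≥0∞ := fun p =>
      ENNReal.ofReal (p.1 ^ 0 * Real.exp (-(p.1 ^ 2 / 2)))
        * ENNReal.ofReal (Real.exp (-((∑ i, p.2 i ^ 2) / 2))) with hF
    have h2 : ∀ x : Fin (d + 1) → ℝ, ENNReal.ofReal (Real.exp (-((∑ i, x i ^ 2) / 2)))
        = F (MeasurableEquiv.piFinSuccAbove (fun _ : Fin (d + 1) => ℝ) 0 x) := by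
      intro x
      simp only [hF]
      rw [← ENNReal.ofReal_mul (by positivity), pow_zero, one_mul, ← Real.exp_add,
        Fin.sum_univ_succ]
      congr 2
      simp only [MeasurableEquiv.piFinSuccAbove, MeasurableEquiv.coe_mk, Fin.insertNthEquiv_zero,
        Fin.consEquiv_symm_apply]
      ring_nf
      rfl
    rw [lintegral_congr h2, he.lintegral_comp (f := F) (by fun_prop)]
    rw [lintegral_pow_mul_gaussian_prod (by simp), lintegral_gaussian_pi d, pow_succ']

/-- The Gaussian second moment in the direction of the first vector of an orthonormal basis. -/
theorem lintegral_inner_sq_mul_gaussian :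
    ∫⁻ x, ENNReal.ofReal (inner ℝ (b 0) x ^ 2)
        * ENNReal.ofReal (Real.exp (-(gauge (closedBall 0 1) x ^ 2 / 2)))
      = 2 * halfMoment 2 * (2 * halfMoment 0) ^ d := by
  simp only [gauge_closedBall zero_le_one, div_one]
  rw [← (measurePreserving_coords b).lintegral_comp (by fun_prop)]
  have h : ∀ p : ℝ × (Fin d → ℝ), ENNReal.ofReal (inner ℝ (b 0) (coords b p) ^ 2)
      * ENNReal.ofReal (Real.exp (-(‖coords b p‖ ^ 2 / 2)))
      = ENNReal.ofReal (p.1 ^ 2 * Real.exp (-(p.1 ^ 2 / 2)))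
        * ENNReal.ofReal (Real.exp (-((∑ i, p.2 i ^ 2) / 2))) := by
    intro p
    rw [← coords_one_zero, inner_coords, norm_coords_sq, ← ENNReal.ofReal_mul (by positivity),
      ← ENNReal.ofReal_mul (by positivity), mul_assoc, ← Real.exp_add]
    simp only [pairing, one_mul, zero_dotProduct, add_zero]
    ring_nf
  simp only [h]
  rw [lintegral_pow_mul_gaussian_prod even_two, lintegral_gaussian_pi]

end

section

variable {d n : ℕ}

/-! ### The Santaló inequality for second moments in dual directions -/

theorem lintegral_eq_two_mul_halfVolume {k : ℝ × (Fin d → ℝ) → ℝ≥0∞} (hk : Measurable k)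
    (heven : ∀ p, k (-p) = k p) : ∫⁻ p, k p = 2 * ∫⁻ p, k p ∂halfVolume d := by
  rw [lintegral_eq_halfVolume_add hk, two_mul]
  congr 1
  have h1 : ∀ p : ℝ × (Fin d → ℝ), k (-p.1, p.2) = k (p.1, -p.2) := fun p => by
    rw [← heven]
    simp
  simp only [h1]
  rw [lintegral_halfVolume hk, lintegral_halfVolume (by fun_prop)]
  exact (Measure.measurePreserving_neg (volume : Measure (Fin d → ℝ))).lintegral_comp
    (f := fun x => ∫⁻ s in Ioi 0, k (s, x)) (Measurable.lintegral_prod_left' (f := k) hk)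

variable (b : OrthonormalBasis (Fin (d + 1)) ℝ (EuclideanSpace ℝ (Fin (d + 1))))

theorem IsSymmBody.lintegral_norm_pow_mul_exp_gauge_ne_top
    {L : Set (EuclideanSpace ℝ (Fin (d + 1)))} (hL : IsSymmBody L) (k : ℕ) :
    ∫⁻ p, ENNReal.ofReal (‖coords b p‖ ^ k)
      * ENNReal.ofReal (Real.exp (-(gauge L (coords b p) ^ 2 / 2))) ∂halfVolume d ≠ ⊤ := by
  have hN := hL.continuous_gauge.measurable
  have h1 := hL.lintegral_mul_exp_gauge (w := fun x => ENNReal.ofReal (‖x‖ ^ k)) (k := k)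
    (by fun_prop) (fun r hr x => by
      rw [norm_smul, Real.norm_of_nonneg hr.le, mul_pow, ENNReal.ofReal_mul (by positivity)])
  have h2 : ∫⁻ x in L, ENNReal.ofReal (‖x‖ ^ k) ≠ ⊤ := by
    have hc : ContinuousOn (fun x : EuclideanSpace ℝ (Fin (d + 1)) => ‖x‖ ^ k) L := by fun_prop
    exact ((lintegral_ofReal_le_lintegral_enorm _).trans_lt
      (hc.integrableOn_compact hL.isCompact).2).ne
  have h3 := ENNReal.mul_ne_top (halfMoment_ne_top (d + 1 + k + 1)) h2
  rw [← h1, ← (measurePreserving_coords b).lintegral_comp (by fun_prop)] at h3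
  refine ne_top_of_le_ne_top h3 ?_
  rw [halfVolume_eq_restrict]
  exact lintegral_mono' Measure.restrict_le_self le_rfl

/-- For every direction `b 0` there is a dual direction `w` such that the second moments of the
Gaussian-type function of `K` in the direction `w`, and of that of its polar body in the direction
`b 0`, satisfy a Santaló inequality. As the inequality remains true if the former function is
replaced, for `0 < s < s₀`, by its maximum with its value at `s = s₀` on the same line, equality
forces the function to be nonincreasing in `s`. -/
theorem IsSymmBody.exists_dual_direction {K : Set (EuclideanSpace ℝ (Fin (d + 1)))}
    (hK : IsSymmBody K) : ∃ w, inner ℝ (b 0) w = 1 ∧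
      (∫⁻ x, ENNReal.ofReal (inner ℝ w x ^ 2) * ENNReal.ofReal (Real.exp (-(gauge K x ^ 2 / 2))))
        * (∫⁻ y, ENNReal.ofReal (inner ℝ (b 0) y ^ 2)
            * ENNReal.ofReal (Real.exp (-(gauge (_root_.polarBody K) y ^ 2 / 2))))
        ≤ (2 * halfMoment 2 * (2 * halfMoment 0) ^ d) ^ 2 ∧
      ((∫⁻ x, ENNReal.ofReal (inner ℝ w x ^ 2) * ENNReal.ofReal (Real.exp (-(gauge K x ^ 2 / 2))))
        * (∫⁻ y, ENNReal.ofReal (inner ℝ (b 0) y ^ 2)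
            * ENNReal.ofReal (Real.exp (-(gauge (_root_.polarBody K) y ^ 2 / 2))))
        = (2 * halfMoment 2 * (2 * halfMoment 0) ^ d) ^ 2 → w = b 0 →
        ∀ s > 0, ∀ x, gauge K (coords b (0, x)) ≤ gauge K (coords b (s, x))) := by
  set L := _root_.polarBody K
  have hL : IsSymmBody L := hK.polarBody
  have hNK := hK.continuous_gauge.measurable
  have hNL := hL.continuous_gauge.measurable
  set g : ℝ × (Fin d → ℝ) → ℝ≥0∞ := fun y =>
    ENNReal.ofReal (Real.exp (-(gauge L (coords b y) ^ 2 / 2))) with hg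
  have hgm : Measurable g := by fun_prop
  have hsq : ∀ y : ℝ × (Fin d → ℝ), y.1 ^ 2 ≤ ‖coords b y‖ ^ 2 := fun y =>
    sq_le_sq.2 (by rw [abs_norm]; exact abs_fst_le_norm_coords b y)
  have hfin : ∫⁻ y, ENNReal.ofReal (y.1 ^ 2) * g y ∂halfVolume d ≠ ⊤ := by
    refine ne_top_of_le_ne_top (hL.lintegral_norm_pow_mul_exp_gauge_ne_top b 2)
      (lintegral_mono fun y => ?_)
    gcongr ?_ * _
    exact ENNReal.ofReal_le_ofReal (hsq y)
  have hmom : ∀ r : ℝ × (Fin d → ℝ) → ℝ≥0∞, Measurable r →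
      (∀ y, r y ≤ ENNReal.ofReal ‖coords b y‖) →
      ∫⁻ y, r y ∂((halfVolume d).withDensity fun y => ENNReal.ofReal (y.1 ^ 2) * g y) < ⊤ := by
    intro r hr hle
    rw [lintegral_withDensity_eq_lintegral_mul _ (by fun_prop) hr]
    refine (ne_top_of_le_ne_top (hL.lintegral_norm_pow_mul_exp_gauge_ne_top b 3)
      (lintegral_mono fun y => ?_)).lt_top
    calc ENNReal.ofReal (y.1 ^ 2) * g y * r y
        ≤ ENNReal.ofReal (‖coords b y‖ ^ 2) * g y * ENNReal.ofReal ‖coords b y‖ := by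
          exact mul_le_mul' (mul_le_mul' (ENNReal.ofReal_le_ofReal (hsq y)) le_rfl) (hle y)
      _ = _ := by
          rw [pow_succ _ 2, ENNReal.ofReal_mul (by positivity)]
          ring
  obtain ⟨v, hv⟩ := exists_shear_lintegral_mul_le hgm hfin
    ⟨by fun_prop, hmom _ (by fun_prop) fun y => by
      rw [Real.enorm_eq_ofReal_abs]
      exact ENNReal.ofReal_le_ofReal (abs_fst_le_norm_coords b y)⟩
    ⟨by fun_prop, hmom _ (by fun_prop) fun y => by
      rw [← ofReal_norm]
      exact ENNReal.ofReal_le_ofReal (norm_snd_le_norm_coords b y)⟩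
  have hcs : Continuous (dualShear v) := by
    unfold dualShear dotProduct
    fun_prop
  set N : ℝ × (Fin d → ℝ) → ℝ := fun x => gauge K (coords b (dualShear v x)) with hN
  have hNc : Continuous N := hK.continuous_gauge.comp ((continuous_coords b).comp hcs)
  have hNm : Measurable N := hNc.measurable
  set f : ℝ × (Fin d → ℝ) → ℝ≥0∞ := fun x => ENNReal.ofReal (Real.exp (-(N x ^ 2 / 2))) with hf
  have hfm : Measurable f := by fun_prop
  have hfg : ∀ x y, f x * g (shear 0 v y) ≤ ENNReal.ofReal (Real.exp (-pairing x y)) := by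
    intro x y
    refine (hK.exp_gauge_mul_exp_gauge_le _ _).trans_eq ?_
    rw [inner_coords]
    have := pairing_dualShear_affine_shear 0 0 v x y
    simp only [zero_add] at this
    simp only [shear, zero_add, this]
    simp [pairing]
  set D : ℝ≥0∞ := halfMoment 2 ^ 2 * (4 * halfMoment 0 ^ 2) ^ d with hD
  set J := ∫⁻ y, ENNReal.ofReal (y.1 ^ 2) * g y ∂halfVolume d with hJ
  set I := ∫⁻ x, ENNReal.ofReal (x.1 ^ 2) * f x ∂halfVolume d with hI
  have hIJ : I * J ≤ D := hv f hfm fun x y _ _ => hfg x y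
  set w := coords b (1, v) with hw
  have hGK : ∫⁻ x, ENNReal.ofReal (inner ℝ w x ^ 2)
      * ENNReal.ofReal (Real.exp (-(gauge K x ^ 2 / 2))) = 2 * I := by
    rw [hI, ← lintegral_eq_two_mul_halfVolume (by fun_prop),
      ← (measurePreserving_coords b).lintegral_comp (by fun_prop),
      ← (measurePreserving_dualShear v).lintegral_comp (by fun_prop)]
    · congr 1 with x
      rw [hw, inner_coords]
      have : pairing (1, v) (dualShear v x) = x.1 := by
        simp only [pairing, dualShear, one_mul]
        rw [dotProduct_comm]
        ring
      rw [this]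
    · intro x
      have : dualShear v (-x) = -dualShear v x := by
        ext1 <;> simp [dualShear]
        ring
      simp only [hf, hN, this, coords_neg, hK.gauge_neg, Prod.fst_neg, even_two.neg_pow]
  have hGL : ∫⁻ y, ENNReal.ofReal (inner ℝ (b 0) y ^ 2)
      * ENNReal.ofReal (Real.exp (-(gauge L y ^ 2 / 2))) = 2 * J := by
    rw [hJ, ← lintegral_eq_two_mul_halfVolume (by fun_prop),
      ← (measurePreserving_coords b).lintegral_comp (by fun_prop)]
    · congr 1 with x
      rw [← coords_one_zero, inner_coords]
      simp [pairing, hg]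
    · intro x
      simp only [hg, coords_neg, hL.gauge_neg, Prod.fst_neg, even_two.neg_pow]
  have hGD : (2 * halfMoment 2 * (2 * halfMoment 0) ^ d) ^ 2 = 4 * D := by
    rw [hD, mul_pow, mul_pow, ← pow_mul, mul_comm d 2, pow_mul, mul_pow]
    norm_num
    ring
  have h4 : 2 * I * (2 * J) = 4 * (I * J) := by ring
  have hDt : D ≠ ⊤ := by
    rw [hD]
    exact ENNReal.mul_ne_top (ENNReal.pow_ne_top (halfMoment_ne_top 2))
      (ENNReal.pow_ne_top (ENNReal.mul_ne_top (by simp) (ENNReal.pow_ne_top (halfMoment_ne_top 0))))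
  have hD0 : D ≠ 0 := by
    rw [hD]
    exact mul_ne_zero (pow_ne_zero _ (halfMoment_ne_zero 2))
      (pow_ne_zero _ (mul_ne_zero (by simp) (pow_ne_zero _ (halfMoment_ne_zero 0))))
  refine ⟨w, ?_, ?_, ?_⟩
  · rw [← coords_one_zero, hw, inner_coords]
    simp [pairing]
  · rw [hGK, hGL, hGD, h4]
    gcongr
  · rw [hGK, hGL, hGD, h4]
    intro heq hwb s hs x
    have hv0 : v = 0 := by
      have h1 : inner ℝ w (coords b (0, v)) = inner ℝ (b 0) (coords b (0, v)) := by rw [hwb]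
      rw [hw, ← coords_one_zero, inner_coords, inner_coords] at h1
      simpa [pairing] using h1
    have heq' : I * J = D := (ENNReal.mul_right_inj (by simp) (by simp)).1 heq
    have hJ0 : J ≠ 0 := fun h => hD0 (by rw [← heq', h, mul_zero])
    have hIt : I ≠ ⊤ := fun h => hDt (by rw [← heq', h, ENNReal.top_mul hJ0])
    -- the competitor: `f` raised on `0 < x.1 < s` to its value at `x.1 = s`
    set f' : ℝ × (Fin d → ℝ) → ℝ≥0∞ := fun x =>
      max (f x) ({x : ℝ × (Fin d → ℝ) | x.1 < s}.indicator (fun x => f (s, x.2)) x) with hf'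
    have hms : MeasurableSet {x : ℝ × (Fin d → ℝ) | x.1 < s} :=
      measurableSet_lt measurable_fst measurable_const
    have hfm' : Measurable f' := hfm.max (Measurable.indicator (by fun_prop) hms)
    have hIJ' := hv f' hfm' fun x y hx hy => by
      rcases max_choice (f x) ({x : ℝ × (Fin d → ℝ) | x.1 < s}.indicator (fun x => f (s, x.2)) x)
        with h | h
      · simp only [hf', h]
        exact hfg x y
      · simp only [hf', h]
        by_cases hxs : x.1 < s
        · rw [indicator_of_mem (show x ∈ {x : ℝ × (Fin d → ℝ) | x.1 < s} from hxs)]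
          refine (hfg _ _).trans (ENNReal.ofReal_le_ofReal (Real.exp_le_exp.2 ?_))
          simp only [pairing]
          nlinarith
        · rw [indicator_of_notMem (show x ∉ {x : ℝ × (Fin d → ℝ) | x.1 < s} from hxs)]
          simp
    rw [← heq'] at hIJ'
    have hle := (ENNReal.mul_le_mul_iff_left hJ0 hfin).1 hIJ'
    have hae := ae_eq_of_ae_le_of_lintegral_le (μ := halfVolume d)
      (f := fun x => ENNReal.ofReal (x.1 ^ 2) * f x) (g := fun x => ENNReal.ofReal (x.1 ^ 2) * f' x)
      (ae_of_all _ fun x => mul_le_mul_right (le_max_left _ _) _) hIt (by fun_prop) hle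
    -- `f' = f` almost everywhere, so the open set where `f` is smaller than at `x.1 = s` is empty
    set U : Set (ℝ × (Fin d → ℝ)) := {x | 0 < x.1 ∧ x.1 < s ∧ N (s, x.2) < N x}
    have hUo : IsOpen U := (isOpen_lt continuous_const continuous_fst).inter
      ((isOpen_lt continuous_fst continuous_const).inter (isOpen_lt (by fun_prop) hNc))
    have hU0 : halfVolume d U = 0 := by
      refine measure_mono_null (fun x hx => ?_) hae
      obtain ⟨h1, h2, h3⟩ := hx
      intro h
      have h : ENNReal.ofReal (x.1 ^ 2) * f x = ENNReal.ofReal (x.1 ^ 2) * f' x := h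
      rw [ENNReal.mul_right_inj (ENNReal.ofReal_pos.2 (by positivity)).ne' (by simp)] at h
      have h4 : f (s, x.2) ≤ f' x := by
        refine le_trans (le_of_eq ?_) (le_max_right _ _)
        rw [indicator_of_mem (show x ∈ {x : ℝ × (Fin d → ℝ) | x.1 < s} from h2)]
      rw [← h, ENNReal.ofReal_le_ofReal_iff (Real.exp_pos _).le, Real.exp_le_exp] at h4
      have : 0 ≤ N (s, x.2) := gauge_nonneg _
      nlinarith
    have hUe : U = ∅ := by
      rw [← hUo.measure_eq_zero_iff volume]
      rw [halfVolume_eq_restrict, Measure.restrict_apply hUo.measurableSet,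
        inter_eq_left.2 (show U ⊆ Ioi 0 ×ˢ univ from fun x hx => ⟨hx.1, mem_univ _⟩)] at hU0
      exact hU0
    have hlim : N (0, x) ≤ N (s, x) := by
      have hmem : (0 : ℝ) ∈ closure (Ioo 0 s) := by
        rw [closure_Ioo hs.ne]
        exact ⟨le_rfl, hs.le⟩
      refine ContinuousWithinAt.closure_le (f := fun t => N (t, x)) (g := fun _ => N (s, x)) hmem
        (by fun_prop) (by fun_prop) fun t ht => ?_
      by_contra! hcon
      have : (t, x) ∈ U := ⟨ht.1, ht.2, hcon⟩
      rw [hUe] at this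
      exact this
    simpa [hN, dualShear, hv0] using hlim

end

section

variable {d n : ℕ}

/-! ### Bodies in isotropic position -/

/-- The second moment `∫_S ⟪w, x⟫² dx` of a set in the direction `w`. -/
noncomputable def secondMoment (S : Set (EuclideanSpace ℝ (Fin n)))
    (w : EuclideanSpace ℝ (Fin n)) : ℝ := ∫ x in S, inner ℝ w x ^ 2

theorem secondMoment_nonneg (S : Set (EuclideanSpace ℝ (Fin n))) (w : EuclideanSpace ℝ (Fin n)) :
    0 ≤ secondMoment S w := integral_nonneg fun _ => sq_nonneg _

theorem integrableOn_inner_sq {S : Set (EuclideanSpace ℝ (Fin n))} (hS : IsCompact S)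
    (w : EuclideanSpace ℝ (Fin n)) : IntegrableOn (fun x => (inner ℝ w x : ℝ) ^ 2) S :=
  ContinuousOn.integrableOn_compact hS (by fun_prop)

theorem secondMoment_smul (S : Set (EuclideanSpace ℝ (Fin n))) (r : ℝ)
    (w : EuclideanSpace ℝ (Fin n)) : secondMoment S (r • w) = r ^ 2 * secondMoment S w := by
  simp only [secondMoment, real_inner_smul_left, mul_pow, integral_const_mul]

theorem IsSymmBody.lintegral_inner_sq_mul_exp_gauge {K : Set (EuclideanSpace ℝ (Fin n))}
    (hK : IsSymmBody K) (w : EuclideanSpace ℝ (Fin n)) :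
    ∫⁻ x, ENNReal.ofReal (inner ℝ w x ^ 2) * ENNReal.ofReal (Real.exp (-(gauge K x ^ 2 / 2)))
      = halfMoment (n + 2 + 1) * ENNReal.ofReal (secondMoment K w) := by
  rw [hK.lintegral_mul_exp_gauge (w := fun x => ENNReal.ofReal (inner ℝ w x ^ 2)) (k := 2)
    (by fun_prop) (fun r hr x => by
      rw [real_inner_smul_right, mul_pow, ENNReal.ofReal_mul (by positivity)]), secondMoment,
    ofReal_integral_eq_lintegral_ofReal (integrableOn_inner_sq hK.isCompact w)
      (ae_of_all _ fun x => sq_nonneg _)]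

theorem IsSymmBody.secondMoment_pos {K : Set (EuclideanSpace ℝ (Fin n))} (hK : IsSymmBody K)
    {w : EuclideanSpace ℝ (Fin n)} (hw : w ≠ 0) : 0 < secondMoment K w := by
  rw [secondMoment, setIntegral_pos_iff_support_of_nonneg_ae (ae_of_all _ fun x => sq_nonneg _)
    (integrableOn_inner_sq hK.isCompact w)]
  have ho : IsOpen (interior K ∩ {x | inner ℝ w x ≠ (0 : ℝ)}) :=
    isOpen_interior.inter (isOpen_ne_fun (by fun_prop) continuous_const)
  refine (ho.measure_pos volume ?_).trans_le (measure_mono ?_)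
  · obtain ⟨r, hr, hrK⟩ := Metric.mem_nhds_iff.1 hK.mem_nhds
    have hwn := norm_pos_iff.2 hw
    refine ⟨(r / 2 * ‖w‖⁻¹) • w, interior_maximal hrK isOpen_ball ?_, ?_⟩
    · rw [mem_ball_zero_iff, norm_smul, norm_mul, norm_inv, norm_norm,
        Real.norm_of_nonneg (by positivity), mul_assoc, inv_mul_cancel₀ hwn.ne']
      linarith
    · change inner ℝ w ((r / 2 * ‖w‖⁻¹) • w) ≠ (0 : ℝ)
      rw [real_inner_smul_right, real_inner_self_eq_norm_sq]
      positivity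
  · rintro x ⟨hx1, hx2⟩
    exact ⟨pow_ne_zero 2 hx2, interior_subset hx1⟩

theorem exists_orthonormalBasis_zero_eq {u : EuclideanSpace ℝ (Fin (d + 1))} (hu : ‖u‖ = 1) :
    ∃ b : OrthonormalBasis (Fin (d + 1)) ℝ (EuclideanSpace ℝ (Fin (d + 1))), b 0 = u := by
  have hv : Orthonormal ℝ (({0} : Set (Fin (d + 1))).domRestrict fun _ => u) := by
    refine ⟨fun _ => hu, fun i j hij => absurd (Subsingleton.elim i j) hij⟩
  obtain ⟨b, hb⟩ := hv.exists_orthonormalBasis_extension_of_card_eq (by simp)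
  exact ⟨b, hb 0 rfl⟩

/-- The second moment of the unit ball of `ℝᵈ⁺¹` in any unit direction. -/
noncomputable def ballMoment (d : ℕ) : ℝ :=
  secondMoment (closedBall (0 : EuclideanSpace ℝ (Fin (d + 1))) 1)
    (EuclideanSpace.basisFun (Fin (d + 1)) ℝ 0)

theorem ballMoment_pos (d : ℕ) : 0 < ballMoment d :=
  IsSymmBody.closedBall_zero_one.secondMoment_pos
    (norm_ne_zero_iff.1 (by rw [OrthonormalBasis.norm_eq_one]; exact one_ne_zero))

theorem halfMoment_mul_ofReal_secondMoment_closedBall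
    (b : OrthonormalBasis (Fin (d + 1)) ℝ (EuclideanSpace ℝ (Fin (d + 1)))) :
    halfMoment (d + 1 + 2 + 1) * ENNReal.ofReal (secondMoment (closedBall 0 1) (b 0))
      = 2 * halfMoment 2 * (2 * halfMoment 0) ^ d := by
  rw [← IsSymmBody.closedBall_zero_one.lintegral_inner_sq_mul_exp_gauge,
    lintegral_inner_sq_mul_gaussian]

/-- The ball is isotropic: its second moment in a unit direction is given by the Gaussian one, which
can be computed in any orthonormal basis. -/
theorem secondMoment_closedBall (w : EuclideanSpace ℝ (Fin (d + 1))) :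
    secondMoment (closedBall 0 1) w = ballMoment d * ‖w‖ ^ 2 := by
  rcases eq_or_ne w 0 with rfl | hw
  · simp [secondMoment]
  have hwn := norm_pos_iff.2 hw
  have hu : ‖‖w‖⁻¹ • w‖ = 1 := by
    rw [norm_smul, norm_inv, norm_norm, inv_mul_cancel₀ hwn.ne']
  obtain ⟨b, hb⟩ := exists_orthonormalBasis_zero_eq hu
  have h := (halfMoment_mul_ofReal_secondMoment_closedBall b).trans
    (halfMoment_mul_ofReal_secondMoment_closedBall (EuclideanSpace.basisFun (Fin (d + 1)) ℝ)).symm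
  rw [ENNReal.mul_right_inj (halfMoment_ne_zero _) (halfMoment_ne_top _),
    ENNReal.ofReal_eq_ofReal_iff (secondMoment_nonneg _ _) (secondMoment_nonneg _ _), hb] at h
  have h2 := secondMoment_smul (closedBall 0 1) ‖w‖ (‖w‖⁻¹ • w)
  rw [smul_inv_smul₀ hwn.ne', h] at h2
  rw [h2, ballMoment, mul_comm]

/-- For every unit vector `u` there is a dual vector `w` for which the product of the second moments
of `K` and of its polar body is at most the corresponding value for the ball; and if equality holds
with `w = u` then the gauge of `K` does not increase under orthogonal projection along `u`. -/
theorem IsSymmBody.exists_secondMoment_mul_le {K : Set (EuclideanSpace ℝ (Fin (d + 1)))}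
    (hK : IsSymmBody K) {u : EuclideanSpace ℝ (Fin (d + 1))} (hu : ‖u‖ = 1) :
    ∃ w, inner ℝ u w = 1 ∧
      secondMoment K w * secondMoment (_root_.polarBody K) u ≤ ballMoment d ^ 2 ∧
      (secondMoment K w * secondMoment (_root_.polarBody K) u = ballMoment d ^ 2 → w = u →
        ∀ s : ℝ, 0 < s → ∀ x, inner ℝ u x = 0 → gauge K x ≤ gauge K (x + s • u)) := by
  obtain ⟨b, rfl⟩ := exists_orthonormalBasis_zero_eq hu
  obtain ⟨w, hw1, hw2, hw3⟩ := hK.exists_dual_direction b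
  have hG := halfMoment_mul_ofReal_secondMoment_closedBall b
  rw [secondMoment_closedBall, b.norm_eq_one, one_pow, mul_one] at hG
  have e : ∀ a b c : ℝ≥0∞, a * b * (a * c) = a ^ 2 * (b * c) := fun a b c => by ring
  have hm0 := pow_ne_zero 2 (halfMoment_ne_zero (d + 1 + 2 + 1))
  have hmt := ENNReal.pow_ne_top (n := 2) (halfMoment_ne_top (d + 1 + 2 + 1))
  rw [hK.lintegral_inner_sq_mul_exp_gauge, hK.polarBody.lintegral_inner_sq_mul_exp_gauge, ← hG,
    e, mul_pow, ← ENNReal.ofReal_mul (secondMoment_nonneg _ _),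
    ← ENNReal.ofReal_pow (ballMoment_pos d).le] at hw2 hw3
  refine ⟨w, hw1, ?_, fun heq hwu s hs x hx => ?_⟩
  · rw [ENNReal.mul_le_mul_iff_right hm0 hmt, ENNReal.ofReal_le_ofReal_iff (sq_nonneg _)] at hw2
    exact hw2
  · rw [heq] at hw3
    obtain ⟨p, rfl⟩ := coords_surjective b x
    have hp : p.1 = 0 := by
      rw [← coords_one_zero, inner_coords] at hx
      simpa [pairing] using hx
    have h1 := hw3 rfl hwu s hs p.2
    have h2 : coords b p + s • b 0 = coords b (s, p.2) := by
      simp only [coords, hp, zero_smul, zero_add]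
      exact add_comm _ _
    have h3 : coords b p = coords b (0, p.2) := by simp only [coords, hp]
    rwa [h2, h3]

/-- If one of the two sets is isotropic, the functional is a sum of second moments of the other. -/
theorem innerSqIntegral_eq_of_isotropic {S T : Set (EuclideanSpace ℝ (Fin n))} (hS : IsCompact S)
    (hT : IsCompact T) {a : ℝ} (ha : ∀ w, secondMoment S w = a * ‖w‖ ^ 2)
    (b : OrthonormalBasis (Fin n) ℝ (EuclideanSpace ℝ (Fin n))) :
    innerSqIntegral S T = ∑ i, a * secondMoment T (b i) := by
  have hc : Continuous fun p : EuclideanSpace ℝ (Fin n) × EuclideanSpace ℝ (Fin n) =>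
    (inner ℝ p.1 p.2 : ℝ) ^ 2 := by fun_prop
  have hint : Integrable (Function.uncurry fun x y : EuclideanSpace ℝ (Fin n) =>
      (inner ℝ x y : ℝ) ^ 2) ((volume.restrict S).prod (volume.restrict T)) := by
    rw [Measure.prod_restrict]
    exact hc.continuousOn.integrableOn_compact (hS.prod hT)
  unfold innerSqIntegral
  rw [integral_integral_swap hint]
  have h1 : ∀ y, ∫ x in S, (inner ℝ x y : ℝ) ^ 2 = ∑ i, a * inner ℝ (b i) y ^ 2 := fun y => by
    have hcomm : (fun x => (inner ℝ x y : ℝ) ^ 2) = fun x => inner ℝ y x ^ 2 := by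
      ext x
      rw [real_inner_comm]
    rw [hcomm, ← Finset.mul_sum]
    have := b.sum_sq_norm_inner_right y
    simp only [Real.norm_eq_abs, sq_abs] at this
    rw [this]
    exact ha y
  simp only [h1]
  rw [integral_finsetSum _ fun i _ => (integrableOn_inner_sq hT (b i)).const_mul a]
  simp only [integral_const_mul, secondMoment]

theorem innerSqIntegral_closedBall : innerSqIntegral
    (closedBall (0 : EuclideanSpace ℝ (Fin (d + 1))) 1) (closedBall 0 1)
      = ∑ _i : Fin (d + 1), ballMoment d ^ 2 := by
  rw [innerSqIntegral_eq_of_isotropic (isCompact_closedBall _ _) (isCompact_closedBall _ _)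
    secondMoment_closedBall (EuclideanSpace.basisFun (Fin (d + 1)) ℝ)]
  refine Finset.sum_congr rfl fun i _ => ?_
  rw [secondMoment_closedBall, OrthonormalBasis.norm_eq_one]
  ring

section Isotropic

variable {K : Set (EuclideanSpace ℝ (Fin (d + 1)))} {a : ℝ}

theorem nonneg_of_isotropic (ha : ∀ w, secondMoment K w = a * ‖w‖ ^ 2) : 0 ≤ a := by
  have h := secondMoment_nonneg K (EuclideanSpace.basisFun (Fin (d + 1)) ℝ 0)
  rwa [ha, OrthonormalBasis.norm_eq_one, one_pow, mul_one] at h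

/-- A vector dual to a unit vector has norm at least `1`, so in isotropic position the dual vector
can be replaced by the unit vector itself. -/
theorem IsSymmBody.mul_secondMoment_le (hK : IsSymmBody K)
    (ha : ∀ w, secondMoment K w = a * ‖w‖ ^ 2) {u : EuclideanSpace ℝ (Fin (d + 1))}
    (hu : ‖u‖ = 1) : a * secondMoment (_root_.polarBody K) u ≤ ballMoment d ^ 2 ∧
      (a * secondMoment (_root_.polarBody K) u = ballMoment d ^ 2 →
        ∀ s : ℝ, 0 < s → ∀ x, inner ℝ u x = 0 → gauge K x ≤ gauge K (x + s • u)) := by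
  obtain ⟨w, hw1, hw2, hw3⟩ := hK.exists_secondMoment_mul_le hu
  have ha0 := nonneg_of_isotropic ha
  have hB := secondMoment_nonneg (_root_.polarBody K) u
  have hw : 1 ≤ ‖w‖ ^ 2 := by
    have := real_inner_le_norm u w
    rw [hw1, hu, one_mul] at this
    nlinarith
  rw [ha] at hw2 hw3
  have haB := mul_nonneg ha0 hB
  refine ⟨by nlinarith, fun heq => hw3 ?_ ?_⟩
  · have hpos := pow_pos (ballMoment_pos d) 2
    have : ‖w‖ ^ 2 = 1 := by nlinarith
    rw [this, mul_one, heq]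
  · have hpos := pow_pos (ballMoment_pos d) 2
    have h1 : ‖w‖ ^ 2 = 1 := by nlinarith
    have h2 := norm_sub_sq_real w u
    rw [real_inner_comm, hw1, h1, hu] at h2
    have h3 : ‖w - u‖ ^ 2 = 0 := by rw [h2]; norm_num
    exact sub_eq_zero.1 (norm_eq_zero.1 (pow_eq_zero_iff two_ne_zero |>.1 h3))

theorem IsSymmBody.innerSqIntegral_le_of_isotropic (hK : IsSymmBody K)
    (ha : ∀ w, secondMoment K w = a * ‖w‖ ^ 2) :
    innerSqIntegral K (_root_.polarBody K) ≤ innerSqIntegral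
      (closedBall (0 : EuclideanSpace ℝ (Fin (d + 1))) 1) (closedBall 0 1) := by
  rw [innerSqIntegral_closedBall, innerSqIntegral_eq_of_isotropic hK.isCompact
    hK.polarBody.isCompact ha (EuclideanSpace.basisFun (Fin (d + 1)) ℝ)]
  exact Finset.sum_le_sum fun i _ =>
    (hK.mul_secondMoment_le ha (OrthonormalBasis.norm_eq_one _ i)).1

/-- In the equality case, the orthogonal projection onto every hyperplane maps `K` into itself. -/
theorem IsSymmBody.gauge_le_gauge_add_of_eq (hK : IsSymmBody K)
    (ha : ∀ w, secondMoment K w = a * ‖w‖ ^ 2)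
    (heq : innerSqIntegral K (_root_.polarBody K) = innerSqIntegral
      (closedBall (0 : EuclideanSpace ℝ (Fin (d + 1))) 1) (closedBall 0 1))
    {u : EuclideanSpace ℝ (Fin (d + 1))} (hu : ‖u‖ = 1) {s : ℝ} (hs : 0 < s)
    {x : EuclideanSpace ℝ (Fin (d + 1))} (hx : inner ℝ u x = 0) :
    gauge K x ≤ gauge K (x + s • u) := by
  obtain ⟨b, rfl⟩ := exists_orthonormalBasis_zero_eq hu
  rw [innerSqIntegral_closedBall, innerSqIntegral_eq_of_isotropic hK.isCompact
    hK.polarBody.isCompact ha b, Finset.sum_eq_sum_iff_of_le fun i _ =>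
      (hK.mul_secondMoment_le ha (OrthonormalBasis.norm_eq_one _ i)).1] at heq
  exact (hK.mul_secondMoment_le ha hu).2 (heq 0 (Finset.mem_univ _)) s hs x hx

end Isotropic

/-! ### Bodies mapped into themselves by orthogonal projections -/

/-- A function on the line that satisfies `cos (t - s) * h s ≤ h t` for all `s`, `t` is constant,
because its derivative vanishes. -/
theorem eq_of_cos_mul_le {h : ℝ → ℝ} {M : ℝ} (h0 : ∀ t, 0 ≤ h t) (hM : ∀ t, h t ≤ M)
    (hcos : ∀ s t, Real.cos (t - s) * h s ≤ h t) (s t : ℝ) : h s = h t := by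
  have hquad : ∀ s t, h s - h t ≤ M * (t - s) ^ 2 := by
    intro s t
    have h1 := Real.one_sub_sq_div_two_le_cos (x := t - s)
    have h2 := hcos s t
    have h3 : (1 - (t - s) ^ 2 / 2) * h s ≤ Real.cos (t - s) * h s :=
      mul_le_mul_of_nonneg_right h1 (h0 s)
    have h4 : (t - s) ^ 2 * h s ≤ (t - s) ^ 2 * M := mul_le_mul_of_nonneg_left (hM s) (sq_nonneg _)
    have h5 := mul_nonneg (sq_nonneg (t - s)) (h0 s)
    nlinarith
  have hderiv : ∀ s, HasDerivAt h 0 s := by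
    intro s
    rw [hasDerivAt_iff_isLittleO]
    have hO : (fun t => h t - h s - (t - s) • (0 : ℝ)) =O[𝓝 s] fun t => (t - s) ^ 2 := by
      refine Asymptotics.IsBigO.of_bound M (Filter.Eventually.of_forall fun t => ?_)
      rw [smul_zero, sub_zero, Real.norm_eq_abs, Real.norm_of_nonneg (sq_nonneg _), abs_le]
      have h1 := hquad s t
      have h2 := hquad t s
      constructor
      · linarith
      · nlinarith
    refine hO.trans_isLittleO ?_
    have hz : Tendsto (fun t : ℝ => t - s) (𝓝 s) (𝓝 0) := by
      have : Continuous fun t : ℝ => t - s := by fun_prop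
      simpa using this.tendsto s
    have := (Asymptotics.isLittleO_pow_id (𝕜 := ℝ) one_lt_two).comp_tendsto hz
    exact this
  exact is_const_of_deriv_eq_zero (fun x => (hderiv x).differentiableAt)
    (fun x => (hderiv x).deriv) s t

/-- A body that is mapped into itself by the orthogonal projection onto every hyperplane is a ball:
within a plane, the projection onto a line at angle `θ` shortens a vector by the factor
`cos θ = 1 - O(θ²)` only, so the gauge is constant along great circles. -/
theorem IsSymmBody.exists_gauge_eq_mul_norm {K : Set (EuclideanSpace ℝ (Fin n))}
    (hK : IsSymmBody K)
    (h : ∀ u, ‖u‖ = 1 → ∀ s : ℝ, 0 < s → ∀ x, inner ℝ u x = 0 → gauge K x ≤ gauge K (x + s • u)) :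
    ∃ ρ > 0, ∀ x, gauge K x = ρ * ‖x‖ := by
  -- the vector `⟪x, y⟫ y` is an orthogonal projection of `x`
  have hproj : ∀ x y : EuclideanSpace ℝ (Fin n), ‖y‖ = 1 → inner ℝ x y * gauge K y ≤ gauge K x := by
    intro x y hy
    rcases le_or_gt (inner ℝ x y) 0 with hneg | hpos
    · exact (mul_nonpos_of_nonpos_of_nonneg hneg (gauge_nonneg _)).trans (gauge_nonneg _)
    set c : ℝ := inner ℝ x y
    rw [← IsSymmBody.gauge_smul_of_pos hpos]
    rcases eq_or_ne (x - c • y) 0 with hz | hz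
    · rw [sub_eq_zero.1 hz]
    have hr := norm_pos_iff.2 hz
    have := h (‖x - c • y‖⁻¹ • (x - c • y))
      (by rw [norm_smul, norm_inv, norm_norm, inv_mul_cancel₀ hr.ne'])
      ‖x - c • y‖ hr (c • y) (by
        rw [real_inner_smul_left, real_inner_smul_right, inner_sub_left, real_inner_smul_left,
          real_inner_self_eq_norm_sq, hy]
        simp [c])
    rwa [smul_inv_smul₀ hr.ne', add_sub_cancel] at this
  obtain ⟨M, hM⟩ : ∃ M, ∀ x : EuclideanSpace ℝ (Fin n), ‖x‖ = 1 → gauge K x ≤ M := by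
    obtain ⟨M, hM⟩ := (isCompact_sphere (0 : EuclideanSpace ℝ (Fin n)) 1).bddAbove_image
      hK.continuous_gauge.continuousOn
    exact ⟨M, fun x hx => hM ⟨x, by simpa using hx, rfl⟩⟩
  have hconst : ∀ x y : EuclideanSpace ℝ (Fin n), ‖x‖ = 1 → ‖y‖ = 1 → gauge K x = gauge K y := by
    intro x y hx hy
    set c : ℝ := inner ℝ x y
    rcases eq_or_ne (y - c • x) 0 with hz | hz
    · have hyx := sub_eq_zero.1 hz
      have hc : |c| = 1 := by
        have := congrArg norm hyx
        rwa [hy, norm_smul, hx, mul_one, Real.norm_eq_abs, eq_comm] at this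
      rcases eq_or_eq_neg_of_abs_eq hc with h1 | h1
      · rw [hyx, h1, one_smul]
      · rw [hyx, h1, neg_smul, one_smul, hK.gauge_neg]
    have hr := norm_pos_iff.2 hz
    set e := ‖y - c • x‖⁻¹ • (y - c • x)
    have he : ‖e‖ = 1 := by rw [norm_smul, norm_inv, norm_norm, inv_mul_cancel₀ hr.ne']
    have hxe : inner ℝ x e = 0 := by
      rw [real_inner_smul_right, inner_sub_right, real_inner_smul_right,
        real_inner_self_eq_norm_sq, hx]
      simp [c]
    have hye : y = c • x + ‖y - c • x‖ • e := by rw [smul_inv_smul₀ hr.ne']; abel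
    have hex : inner ℝ e x = 0 := by rw [real_inner_comm, hxe]
    have hinner : ∀ s t : ℝ, inner ℝ (Real.cos s • x + Real.sin s • e)
        (Real.cos t • x + Real.sin t • e) = Real.cos (s - t) := by
      intro s t
      simp only [inner_add_left, inner_add_right, real_inner_smul_left, real_inner_smul_right, hxe,
        hex, real_inner_self_eq_norm_sq, hx, he, Real.cos_sub]
      ring
    have hnorm : ∀ t : ℝ, ‖Real.cos t • x + Real.sin t • e‖ = 1 := by
      intro t
      have := hinner t t
      rw [real_inner_self_eq_norm_sq, sub_self, Real.cos_zero] at this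
      exact (pow_eq_one_iff_of_nonneg (norm_nonneg _) two_ne_zero).1 this
    obtain ⟨θ, h1, h2⟩ : ∃ θ, Real.cos θ = c ∧ Real.sin θ = ‖y - c • x‖ := by
      have hcs : c ^ 2 + ‖y - c • x‖ ^ 2 = 1 := by
        have := norm_sub_sq_real y (c • x)
        rw [real_inner_smul_right, real_inner_comm, norm_smul, hx, hy, mul_one, Real.norm_eq_abs,
          sq_abs] at this
        change ‖y - c • x‖ ^ 2 = 1 ^ 2 - 2 * (c * c) + c ^ 2 at this
        rw [this]
        ring
      refine ⟨Real.arccos c, Real.cos_arccos (by nlinarith) (by nlinarith), ?_⟩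
      rw [Real.sin_arccos, ← hcs, add_sub_cancel_left, Real.sqrt_sq hr.le]
    have := eq_of_cos_mul_le (h := fun t => gauge K (Real.cos t • x + Real.sin t • e)) (M := M)
      (fun t => gauge_nonneg _) (fun t => hM _ (hnorm t)) (fun s t => by
        rw [← hinner]
        exact hproj _ _ (hnorm s)) 0 θ
    simpa [h1, h2, ← hye] using this
  rcases subsingleton_or_nontrivial (EuclideanSpace ℝ (Fin n)) with hs | hs
  · exact ⟨1, one_pos, fun x => by simp [Subsingleton.elim x 0, gauge_zero]⟩
  obtain ⟨x0, hx0⟩ := exists_norm_eq (EuclideanSpace ℝ (Fin n)) zero_le_one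
  refine ⟨gauge K x0, hK.gauge_pos (norm_ne_zero_iff.1 (by rw [hx0]; exact one_ne_zero)),
    fun x => ?_⟩
  rcases eq_or_ne x 0 with rfl | hx
  · simp [gauge_zero]
  have hxn := norm_pos_iff.2 hx
  have h1 : ‖‖x‖⁻¹ • x‖ = 1 := by rw [norm_smul, norm_inv, norm_norm, inv_mul_cancel₀ hxn.ne']
  have h2 := hconst _ _ h1 hx0
  rw [IsSymmBody.gauge_smul_of_pos (inv_pos.2 hxn)] at h2
  rw [← h2]
  field_simp

end

section

variable {d n : ℕ}

/-! ### Linear images -/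

theorem setIntegral_linearEquiv_image {S : Set (EuclideanSpace ℝ (Fin n))} (hS : MeasurableSet S)
    (T : EuclideanSpace ℝ (Fin n) ≃ₗ[ℝ] EuclideanSpace ℝ (Fin n))
    (g : EuclideanSpace ℝ (Fin n) → ℝ) :
    ∫ x in T '' S, g x = |LinearMap.det T.toLinearMap| * ∫ x in S, g (T x) := by
  have h := integral_image_eq_integral_abs_det_fderiv_smul (f := T)
    (f' := fun _ => LinearMap.toContinuousLinearMap T.toLinearMap) volume hS
    (fun x _ => (LinearMap.toContinuousLinearMap T.toLinearMap).hasFDerivWithinAt)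
    T.injective.injOn g
  rw [h, ← integral_const_mul]
  rfl

/-- The inverse of the adjoint of a linear automorphism. -/
noncomputable def dualEquiv (T : EuclideanSpace ℝ (Fin n) ≃ₗ[ℝ] EuclideanSpace ℝ (Fin n)) :
    EuclideanSpace ℝ (Fin n) ≃ₗ[ℝ] EuclideanSpace ℝ (Fin n) :=
  LinearEquiv.ofLinearMap (LinearMap.adjoint T.symm.toLinearMap) (LinearMap.adjoint T.toLinearMap)
    (by rw [← LinearMap.adjoint_comp]; simp)
    (by rw [← LinearMap.adjoint_comp]; simp)

theorem inner_dualEquiv (T : EuclideanSpace ℝ (Fin n) ≃ₗ[ℝ] EuclideanSpace ℝ (Fin n))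
    (x y : EuclideanSpace ℝ (Fin n)) : inner ℝ (T x) (dualEquiv T y) = inner ℝ x y := by
  have : dualEquiv T y = LinearMap.adjoint T.symm.toLinearMap y := rfl
  rw [this, LinearMap.adjoint_inner_right]
  simp

theorem det_adjoint (f : EuclideanSpace ℝ (Fin n) →ₗ[ℝ] EuclideanSpace ℝ (Fin n)) :
    LinearMap.det (LinearMap.adjoint f) = LinearMap.det f := by
  have b := EuclideanSpace.basisFun (Fin n) ℝ
  rw [← LinearMap.det_toMatrix b.toBasis, ← LinearMap.det_toMatrix b.toBasis,
    LinearMap.toMatrix_adjoint, Matrix.det_conjTranspose]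
  simp

theorem abs_det_mul_abs_det_dualEquiv
    (T : EuclideanSpace ℝ (Fin n) ≃ₗ[ℝ] EuclideanSpace ℝ (Fin n)) :
    |LinearMap.det T.toLinearMap| * |LinearMap.det (dualEquiv T).toLinearMap| = 1 := by
  have : (dualEquiv T).toLinearMap = LinearMap.adjoint T.symm.toLinearMap := rfl
  rw [this, det_adjoint, ← abs_mul, ← LinearMap.det_comp]
  simp

theorem polarBody_image (T : EuclideanSpace ℝ (Fin n) ≃ₗ[ℝ] EuclideanSpace ℝ (Fin n))
    (S : Set (EuclideanSpace ℝ (Fin n))) :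
    polarBody (T '' S) = dualEquiv T '' polarBody S := by
  ext y
  obtain ⟨z, rfl⟩ := (dualEquiv T).surjective y
  rw [(dualEquiv T).injective.mem_set_image]
  simp only [polarBody, forall_mem_image, mem_ofPred_eq]
  refine forall₂_congr fun x _ => ?_
  rw [real_inner_comm, inner_dualEquiv, real_inner_comm]

/-- The functional is invariant under linear automorphisms, acting on the polar body by the
inverse of the adjoint. -/
theorem innerSqIntegral_image {S P : Set (EuclideanSpace ℝ (Fin n))} (hS : MeasurableSet S)
    (hP : MeasurableSet P) (T : EuclideanSpace ℝ (Fin n) ≃ₗ[ℝ] EuclideanSpace ℝ (Fin n)) :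
    innerSqIntegral (T '' S) (dualEquiv T '' P) = innerSqIntegral S P := by
  unfold innerSqIntegral
  rw [setIntegral_linearEquiv_image hS]
  simp only [setIntegral_linearEquiv_image hP, inner_dualEquiv, integral_const_mul]
  rw [← mul_assoc, abs_det_mul_abs_det_dualEquiv, one_mul]

theorem IsSymmBody.image {K : Set (EuclideanSpace ℝ (Fin n))} (hK : IsSymmBody K)
    (T : EuclideanSpace ℝ (Fin n) ≃ₗ[ℝ] EuclideanSpace ℝ (Fin n)) : IsSymmBody (T '' K) := by
  refine ⟨hK.convex.linear_image T.toLinearMap,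
    hK.isCompact.image T.toLinearMap.continuous_of_finiteDimensional, ?_, ?_⟩
  · rintro _ ⟨x, hx, rfl⟩
    exact ⟨-x, hK.neg_mem x hx, map_neg T x⟩
  · have := T.toContinuousLinearEquiv.toHomeomorph.isOpenMap.image_mem_nhds hK.mem_nhds
    simpa using this

theorem IsSymmBody.innerSqIntegral_image {K : Set (EuclideanSpace ℝ (Fin n))} (hK : IsSymmBody K)
    (T : EuclideanSpace ℝ (Fin n) ≃ₗ[ℝ] EuclideanSpace ℝ (Fin n)) :
    innerSqIntegral (T '' K) (_root_.polarBody (T '' K))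
      = innerSqIntegral K (_root_.polarBody K) := by
  rw [polarBody_image, BallConjecture.innerSqIntegral_image hK.isCompact.measurableSet
    hK.polarBody.isCompact.measurableSet]

theorem polarBody_closedBall : polarBody (closedBall (0 : EuclideanSpace ℝ (Fin n)) 1)
    = closedBall 0 1 := by
  ext x
  rw [mem_closedBall_zero_iff]
  constructor
  · intro h
    rcases eq_or_ne x 0 with rfl | hx
    · simp
    have hxn := norm_pos_iff.2 hx
    have := h (‖x‖⁻¹ • x) (by
      rw [mem_closedBall_zero_iff, norm_smul, norm_inv, norm_norm, inv_mul_cancel₀ hxn.ne'])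
    rw [real_inner_smul_right, real_inner_self_eq_norm_sq] at this
    field_simp at this
    exact this
  · intro h y hy
    rw [mem_closedBall_zero_iff] at hy
    exact (real_inner_le_norm x y).trans (mul_le_one₀ h (norm_nonneg _) hy)

/-! ### The isotropic position -/

/-- The inertia operator `w ↦ ∫_S ⟪w, x⟫ x dx` of a compact set. -/
noncomputable def inertia {S : Set (EuclideanSpace ℝ (Fin n))} (hS : IsCompact S) :
    EuclideanSpace ℝ (Fin n) →ₗ[ℝ] EuclideanSpace ℝ (Fin n) where
  toFun w := ∫ x in S, (inner ℝ w x : ℝ) • x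
  map_add' w z := by
    simp only [inner_add_left, add_smul]
    exact integral_add (ContinuousOn.integrableOn_compact hS (by fun_prop))
      (ContinuousOn.integrableOn_compact hS (by fun_prop))
  map_smul' r w := by
    simp only [real_inner_smul_left, mul_smul, RingHom.id_apply]
    exact integral_smul _ _

theorem inner_inertia {S : Set (EuclideanSpace ℝ (Fin n))} (hS : IsCompact S)
    (w z : EuclideanSpace ℝ (Fin n)) :
    inner ℝ z (inertia hS w) = ∫ x in S, inner ℝ w x * inner ℝ z x := by
  have hi : IntegrableOn (fun x => (inner ℝ w x : ℝ) • x) S :=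
    ContinuousOn.integrableOn_compact hS (by fun_prop)
  have := integral_inner (𝕜 := ℝ) hi z
  simp only [real_inner_smul_right] at this
  exact this.symm

theorem isSymmetric_inertia {S : Set (EuclideanSpace ℝ (Fin n))} (hS : IsCompact S) :
    (inertia hS).IsSymmetric := by
  intro w z
  rw [real_inner_comm, inner_inertia, inner_inertia]
  simp only [mul_comm]

/-- The linear map that is diagonal with entries `c` in the orthonormal basis `b`. -/
noncomputable def diagonal (b : OrthonormalBasis (Fin n) ℝ (EuclideanSpace ℝ (Fin n)))
    (c : Fin n → ℝ) : EuclideanSpace ℝ (Fin n) →ₗ[ℝ] EuclideanSpace ℝ (Fin n) :=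
  ∑ i, c i • (innerₛₗ ℝ (b i)).smulRight (b i)

theorem inner_diagonal (b : OrthonormalBasis (Fin n) ℝ (EuclideanSpace ℝ (Fin n)))
    (c : Fin n → ℝ) (i : Fin n) (x : EuclideanSpace ℝ (Fin n)) :
    inner ℝ (b i) (diagonal b c x) = c i * inner ℝ (b i) x := by
  simp [diagonal, inner_sum, real_inner_smul_right, b.inner_eq_ite]

theorem inner_diagonal_comm (b : OrthonormalBasis (Fin n) ℝ (EuclideanSpace ℝ (Fin n)))
    (c : Fin n → ℝ) (x y : EuclideanSpace ℝ (Fin n)) :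
    inner ℝ x (diagonal b c y) = inner ℝ (diagonal b c x) y := by
  rw [← b.sum_inner_mul_inner, ← b.sum_inner_mul_inner]
  refine Finset.sum_congr rfl fun i _ => ?_
  rw [inner_diagonal, real_inner_comm _ (diagonal b c x), inner_diagonal, real_inner_comm]
  ring

theorem diagonal_comp_diagonal (b : OrthonormalBasis (Fin n) ℝ (EuclideanSpace ℝ (Fin n)))
    {c c' : Fin n → ℝ} (h : ∀ i, c i * c' i = 1) :
    diagonal b c ∘ₗ diagonal b c' = LinearMap.id := by
  ext1 x
  refine b.repr.injective ?_
  ext i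
  rw [b.repr_apply_apply, b.repr_apply_apply, LinearMap.comp_apply, inner_diagonal,
    inner_diagonal, ← mul_assoc, h, one_mul, LinearMap.id_apply]

/-- Every symmetric convex body has a linear image in isotropic position. -/
theorem IsSymmBody.exists_isotropic_image {K : Set (EuclideanSpace ℝ (Fin n))}
    (hK : IsSymmBody K) :
    ∃ (T : EuclideanSpace ℝ (Fin n) ≃ₗ[ℝ] EuclideanSpace ℝ (Fin n)) (a : ℝ),
      ∀ w, secondMoment (T '' K) w = a * ‖w‖ ^ 2 := by
  have hsymm := isSymmetric_inertia hK.isCompact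
  have hn : Module.finrank ℝ (EuclideanSpace ℝ (Fin n)) = n := by simp
  set b := hsymm.eigenvectorBasis hn
  set l := hsymm.eigenvalues hn
  have hmom : ∀ w, secondMoment K w = inner ℝ w (inertia hK.isCompact w) := fun w => by
    rw [inner_inertia, secondMoment]
    simp only [pow_two]
  have heig : ∀ i x, inner ℝ (b i) (inertia hK.isCompact x) = l i * inner ℝ (b i) x := by
    intro i x
    rw [← hsymm (b i) x, hsymm.apply_eigenvectorBasis hn i]
    exact real_inner_smul_left _ _ _
  have hl : ∀ i, 0 < l i := by
    intro i
    have := hK.secondMoment_pos (norm_ne_zero_iff.1 (by rw [b.norm_eq_one i]; exact one_ne_zero))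
    rwa [hmom, heig, real_inner_self_eq_norm_sq, b.norm_eq_one, one_pow, mul_one] at this
  have hs : ∀ i, √(l i) ≠ 0 := fun i => (Real.sqrt_pos.2 (hl i)).ne'
  set T := LinearEquiv.ofLinearMap (diagonal b fun i => (√(l i))⁻¹) (diagonal b fun i => √(l i))
    (diagonal_comp_diagonal b fun i => inv_mul_cancel₀ (hs i))
    (diagonal_comp_diagonal b fun i => mul_inv_cancel₀ (hs i))
  have hT : ∀ x, T x = diagonal b (fun i => (√(l i))⁻¹) x := fun _ => rfl
  refine ⟨T, |LinearMap.det T.toLinearMap|, fun w => ?_⟩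
  rw [secondMoment, setIntegral_linearEquiv_image hK.isCompact.measurableSet]
  congr 1
  simp only [hT, inner_diagonal_comm]
  change secondMoment K _ = _
  rw [hmom, ← b.sum_inner_mul_inner, ← b.sum_sq_norm_inner_right w]
  refine Finset.sum_congr rfl fun i _ => ?_
  rw [heig, real_inner_comm, inner_diagonal, Real.norm_eq_abs, sq_abs]
  have h1 := Real.sq_sqrt (hl i).le
  have h2 := hs i
  calc (√(l i))⁻¹ * inner ℝ (b i) w * (l i * ((√(l i))⁻¹ * inner ℝ (b i) w))
      = (√(l i))⁻¹ * inner ℝ (b i) w * (√(l i) ^ 2 * ((√(l i))⁻¹ * inner ℝ (b i) w)) := by rw [h1]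
    _ = inner ℝ (b i) w ^ 2 := by field_simp

/-! ### Ball's inequality -/

theorem IsSymmBody.isOriginSymmetricEllipsoid_of_gauge_eq {K : Set (EuclideanSpace ℝ (Fin n))}
    (hK : IsSymmBody K) (T : EuclideanSpace ℝ (Fin n) ≃ₗ[ℝ] EuclideanSpace ℝ (Fin n)) {ρ : ℝ}
    (hρ : 0 < ρ) (h : ∀ x, gauge (T '' K) x = ρ * ‖x‖) : IsOriginSymmetricEllipsoid K := by
  refine ⟨(LinearEquiv.smulOfNeZero ℝ _ ρ⁻¹ (inv_ne_zero hρ.ne')).trans T.symm, ?_⟩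
  ext x
  constructor
  · intro hx
    refine ⟨ρ • T x, ?_, by simp [hρ.ne']⟩
    rw [mem_closedBall_zero_iff, norm_smul, Real.norm_of_nonneg hρ.le, ← h,
      (hK.image T).gauge_le_one_iff]
    exact mem_image_of_mem T hx
  · rintro ⟨y, hy, rfl⟩
    rw [mem_closedBall_zero_iff] at hy
    have : ρ⁻¹ • y ∈ T '' K := by
      rw [← (hK.image T).gauge_le_one_iff, h, norm_smul, norm_inv, Real.norm_of_nonneg hρ.le,
        mul_inv_cancel_left₀ hρ.ne']
      exact hy
    obtain ⟨z, hz, hzy⟩ := this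
    have : T.symm (ρ⁻¹ • y) = z := by rw [← hzy, T.symm_apply_apply]
    simpa [← this] using hz

theorem IsOriginSymmetricEllipsoid.innerSqIntegral_eq {K : Set (EuclideanSpace ℝ (Fin n))}
    (h : IsOriginSymmetricEllipsoid K) : innerSqIntegral K (polarBody K)
      = innerSqIntegral (closedBall (0 : EuclideanSpace ℝ (Fin n)) 1) (closedBall 0 1) := by
  obtain ⟨T, rfl⟩ := h
  rw [IsSymmBody.closedBall_zero_one.innerSqIntegral_image, polarBody_closedBall]

theorem IsSymmBody.innerSqIntegral_le {K : Set (EuclideanSpace ℝ (Fin (d + 1)))}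
    (hK : IsSymmBody K) : innerSqIntegral K (_root_.polarBody K) ≤ innerSqIntegral
      (closedBall (0 : EuclideanSpace ℝ (Fin (d + 1))) 1) (closedBall 0 1) := by
  obtain ⟨T, a, ha⟩ := hK.exists_isotropic_image
  rw [← hK.innerSqIntegral_image T]
  exact (hK.image T).innerSqIntegral_le_of_isotropic ha

theorem IsSymmBody.isOriginSymmetricEllipsoid_of_eq {K : Set (EuclideanSpace ℝ (Fin (d + 1)))}
    (hK : IsSymmBody K) (h : innerSqIntegral K (_root_.polarBody K) = innerSqIntegral
      (closedBall (0 : EuclideanSpace ℝ (Fin (d + 1))) 1) (closedBall 0 1)) :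
    IsOriginSymmetricEllipsoid K := by
  obtain ⟨T, a, ha⟩ := hK.exists_isotropic_image
  rw [← hK.innerSqIntegral_image T] at h
  obtain ⟨ρ, hρ, hg⟩ := (hK.image T).exists_gauge_eq_mul_norm fun u hu s hs x hx =>
    (hK.image T).gauge_le_gauge_add_of_eq ha h hu hs hx
  exact hK.isOriginSymmetricEllipsoid_of_gauge_eq T hρ hg

end

end BallConjecture

theorem mainTheorem1 (n : ℕ) (K : Set (EuclideanSpace ℝ (Fin n)))
    (hK_convex : Convex ℝ K) (hK_compact : IsCompact K) (hK_interior : (interior K).Nonempty)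
    (hK_symm : ∀ x, x ∈ K ↔ -x ∈ K) :
    innerSqIntegral K (polarBody K) ≤ innerSqIntegral (closedBall 0 1 : Set (EuclideanSpace ℝ (Fin n))) (closedBall 0 1) ∧
    (innerSqIntegral K (polarBody K) =
        innerSqIntegral (closedBall 0 1 : Set (EuclideanSpace ℝ (Fin n))) (closedBall 0 1) ↔
      IsOriginSymmetricEllipsoid K) := by
  have hK := BallConjecture.IsSymmBody.of_interior_nonempty hK_convex hK_compact hK_interior hK_symm
  cases n with
  | zero =>
    -- in dimension `0` the only body is the unit ball `{0}`
    have hE : IsOriginSymmetricEllipsoid K := by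
      refine ⟨LinearEquiv.refl ℝ _, ?_⟩
      ext x
      rw [Subsingleton.elim x 0]
      simpa using hK.zero_mem
    have h := BallConjecture.IsOriginSymmetricEllipsoid.innerSqIntegral_eq hE
    exact ⟨h.le, fun _ => hE, fun _ => h⟩
  | succ d =>
    exact ⟨hK.innerSqIntegral_le, hK.isOriginSymmetricEllipsoid_of_eq,
      BallConjecture.IsOriginSymmetricEllipsoid.innerSqIntegral_eq⟩
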